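/- **Setting.** Let $n\ge 1$, $\varepsilon>0$, and let $p,q$ be unknown probability distributions on $[n]=\{1,\dots,n\}$, with $\|p-q\|_1=\sum_{i\in[n]}|p_i-q_i|$. For real $m_1,m_2>0$ let $S_1,S_2$ be two sets of $\mathrm{Pois}(m_1)$ samples from $p$ and $T_1,T_2$ two sets of $\mathrm{Pois}(m_2)$ samples from $q$, all four independent (a set of $\mathrm{Pois}(m)$ samples from $r$ consists of $N$ independent draws from $r$, where $N$ is Poisson with mean $m$). Let $X_i^{S_1},Y_i^{T_1},X_i,Y_i$ be the numbers of occurrences of $i$ in $S_1,T_1,S_2,T_2$. **Algorithm** (with constants $C_1,C_\gamma$ in its thresholds). Put $b=\frac{256\log n}{\varepsilon^2m_2}$, $b'=\frac{256\log n}{m_2}$ and $$B=\Big\{i:\tfrac{X_i^{S_1}}{m_1}>b\Big\}\cup\Big\{i:\tfrac{Y_i^{T_1}}{m_2}>b\Big\},\quad M=\Big\{i: b'\le\max\big\{\tfrac{X_i^{S_1}}{m_1},\tfrac{Y_i^{T_1}}{m_2}\big\}\le b\Big\},\quad H=[n]\setminus(B\cup M).$$ 1. REJECT if there is $i\in[n]$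 with $Y_i\ge 3$ and $X_i\le\frac{m_1\varepsilon^{2/3}}{10\,m_2n^{1/3}}$. 2. Otherwise ACCEPT if all of the following hold, and REJECT if one of them fails: $$R_H=\sum_{i\in H}\frac{\mathbf 1\{Y_i=2\}}{X_i+1}\le C_1\frac{m_2^2}{m_1},\qquad \sum_{i\in B}\Big|\frac{X_i}{m_1}-\frac{Y_i}{m_2}\Big|\le\frac{\varepsilon}{6},$$ $$\sum_{i\in M}\Big((m_2X_i-m_1Y_i)^2-(m_2^2X_i+m_1^2Y_i)\Big)\le\frac{\varepsilon^2m_1^2m_2\log n}{2},$$ $$\sum_{i\in H}\frac{(m_2X_i-m_1Y_i)^2-(m_2^2X_i+m_1^2Y_i)}{X_i+Y_i}\le C_\gamma m_1^{3/2}m_2,$$ where in the last sum terms with $X_i+Y_i=0$ are $0$. **Proposition.** There is an absolute constant $C_1>0$, and for every $\gamma>0$ there is a constant $C_\gamma>0$, such that for all $c,c'>0$ there is $K>0$ with the following property. For every $L\ge K$ there is $n_0$ such that for all $n\ge n_0$, all $\varepsilon\in(n^{-1/12},2]$, all real $m_1$ with $$c\,(n/\varepsilon^2)^{8/9+\gamma}\le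 m_1\le c'n,$$ all real $m_2$ with $$K\max\Big\{\frac{n}{\sqrt{m_1}\,\varepsilon^2},\frac{\sqrt n}{\varepsilon^2}\Big\}\le m_2\le L\max\Big\{\frac{n}{\sqrt{m_1}\,\varepsilon^2},\frac{\sqrt n}{\varepsilon^2}\Big\},$$ and all probability distributions $p,q$ on $[n]$: * with probability at least $99/100$ the algorithm takes at least $m_1$ and at most $3m_1$ samples from $p$, and at most $3L\max\{\frac{n}{\sqrt{m_1}\varepsilon^2},\frac{\sqrt n}{\varepsilon^2}\}$ samples from $q$; * if $p=q$, the algorithm outputs ACCEPT with probability at least $2/3$; * if $\|p-q\|_1\ge\varepsilon$, the algorithm outputs REJECT with probability at least $2/3$. -/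

import Mathlib

open scoped BigOperators NNReal ENNReal

namespace ClosenessTesting

noncomputable section

/-- The `ℓ₁` distance `∑ i, |p i - q i|` of two probability distributions on `{1, …, n}`. -/
def l1Dist {n : ℕ} (p q : PMF (Fin n)) : ℝ :=
  ∑ i, |(p i).toReal - (q i).toReal|

/-- The law of the outcome of `N` independent draws from `p`. -/
def iidDraws {n : ℕ} (p : PMF (Fin n)) : ℕ → PMF (List (Fin n))
  | 0 => PMF.pure []
  | N + 1 => p.bind fun x => (iidDraws p N).map fun l => x :: l

/-- The law of a set of `Pois(m)` samples from `p`: the number `N` of samples is Poisson with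
mean `m`, and given `N` the samples are `N` independent draws from `p`. -/
def poissonSample {n : ℕ} (m : ℝ) (p : PMF (Fin n)) : PMF (List (Fin n)) :=
  (ProbabilityTheory.poissonMeasure m.toNNReal).toPMF.bind fun N => iidDraws p N

/-- The data seen by the tester: two batches of samples `S₁, S₂` (drawn from the first
distribution) and two batches `T₁, T₂` (drawn from the second one). -/
structure Samples (n : ℕ) where
  S₁ : List (Fin n)
  S₂ : List (Fin n)
  T₁ : List (Fin n)
  T₂ : List (Fin n)

/-- The law of the data: `S₁, S₂` are two sets of `Pois(m₁)` samples from `p`, `T₁, T₂` are two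
sets of `Pois(m₂)` samples from `q`, and all four are independent. -/
def samplesLaw {n : ℕ} (p q : PMF (Fin n)) (m₁ m₂ : ℝ) : PMF (Samples n) :=
  (poissonSample m₁ p).bind fun S₁ =>
  (poissonSample m₁ p).bind fun S₂ =>
  (poissonSample m₂ q).bind fun T₁ =>
  (poissonSample m₂ q).bind fun T₂ =>
    PMF.pure ⟨S₁, S₂, T₁, T₂⟩

/-- The probability of an event about the data. -/
def dataProb {n : ℕ} (p q : PMF (Fin n)) (m₁ m₂ : ℝ) (E : Set (Samples n)) : ℝ≥0∞ :=
  (samplesLaw p q m₁ m₂).toOuterMeasure E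

/-- The number of samples taken from the first distribution. -/
def Samples.numP {n : ℕ} (s : Samples n) : ℕ := s.S₁.length + s.S₂.length

/-- The number of samples taken from the second distribution. -/
def Samples.numQ {n : ℕ} (s : Samples n) : ℕ := s.T₁.length + s.T₂.length

/-- `X i`: the number of occurrences of `i` in `S₂`. -/
def Samples.X {n : ℕ} (s : Samples n) (i : Fin n) : ℕ := s.S₂.count i

/-- `Y i`: the number of occurrences of `i` in `T₂`. -/
def Samples.Y {n : ℕ} (s : Samples n) (i : Fin n) : ℕ := s.T₂.count i

/-- The threshold `b = 256 log n / (ε² m₂)`. -/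
def b (n : ℕ) (ε m₂ : ℝ) : ℝ := 256 * Real.log n / (ε ^ 2 * m₂)

/-- The threshold `b' = 256 log n / m₂`. -/
def b' (n : ℕ) (m₂ : ℝ) : ℝ := 256 * Real.log n / m₂

/-- The heavy set `B`, computed from the first batches `S₁, T₁`. -/
def heavy {n : ℕ} (ε m₁ m₂ : ℝ) (s : Samples n) : Finset (Fin n) :=
  Finset.univ.filter (fun i => (s.S₁.count i : ℝ) / m₁ > b n ε m₂) ∪
    Finset.univ.filter (fun i => (s.T₁.count i : ℝ) / m₂ > b n ε m₂)

/-- The medium set `M`, computed from the first batches `S₁, T₁`. -/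
def medium {n : ℕ} (ε m₁ m₂ : ℝ) (s : Samples n) : Finset (Fin n) :=
  {i | b' n m₂ ≤ max ((s.S₁.count i : ℝ) / m₁) ((s.T₁.count i : ℝ) / m₂) ∧
    max ((s.S₁.count i : ℝ) / m₁) ((s.T₁.count i : ℝ) / m₂) ≤ b n ε m₂}

/-- The light set `H`: the complement of `B ∪ M`. -/
def light {n : ℕ} (ε m₁ m₂ : ℝ) (s : Samples n) : Finset (Fin n) :=
  (heavy ε m₁ m₂ s ∪ medium ε m₁ m₂ s)ᶜ

/-- `V_A = ∑_{i ∈ A} |X_i / m₁ - Y_i / m₂|`. -/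
def statV {n : ℕ} (m₁ m₂ : ℝ) (s : Samples n) (A : Finset (Fin n)) : ℝ :=
  ∑ i ∈ A, |(s.X i : ℝ) / m₁ - (s.Y i : ℝ) / m₂|

/-- `W_A = ∑_{i ∈ A} ((m₂ X_i - m₁ Y_i)² - (m₂² X_i + m₁² Y_i))`. -/
def statW {n : ℕ} (m₁ m₂ : ℝ) (s : Samples n) (A : Finset (Fin n)) : ℝ :=
  ∑ i ∈ A, ((m₂ * s.X i - m₁ * s.Y i) ^ 2 - (m₂ ^ 2 * s.X i + m₁ ^ 2 * s.Y i))

/-- `Z_A = ∑_{i ∈ A} ((m₂ X_i - m₁ Y_i)² - (m₂² X_i + m₁² Y_i)) / (X_i + Y_i)`; an index with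
`X_i = Y_i = 0` contributes `0`. -/
def statZ {n : ℕ} (m₁ m₂ : ℝ) (s : Samples n) (A : Finset (Fin n)) : ℝ :=
  ∑ i ∈ A, ((m₂ * s.X i - m₁ * s.Y i) ^ 2 - (m₂ ^ 2 * s.X i + m₁ ^ 2 * s.Y i)) /
    ((s.X i : ℝ) + s.Y i)

/-- `R_A = ∑_{i ∈ A} 1{Y_i = 2} / (X_i + 1)`. -/
def statR {n : ℕ} (s : Samples n) (A : Finset (Fin n)) : ℝ :=
  ∑ i ∈ A, (if s.Y i = 2 then (1 : ℝ) else 0) / ((s.X i : ℝ) + 1)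

/-- The output of a tester. -/
inductive Verdict
  | accept
  | reject

open Classical in
/-- The closeness tester for the extreme case. It knows `n, ε, m₁, m₂`, the constants `Cγ, C₁` in
its thresholds, and the data, but neither of the two distributions. -/
def extremeTest {n : ℕ} (ε m₁ m₂ Cγ C₁ : ℝ) (s : Samples n) : Verdict :=
  if ∃ i, 3 ≤ s.Y i ∧
      (s.X i : ℝ) ≤ m₁ * ε ^ (2 / 3 : ℝ) / (10 * m₂ * (n : ℝ) ^ (1 / 3 : ℝ)) then
    Verdict.reject
  else if statR s (light ε m₁ m₂ s) ≤ C₁ * (m₂ ^ 2 / m₁) ∧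
      statV m₁ m₂ s (heavy ε m₁ m₂ s) ≤ ε / 6 ∧
      statW m₁ m₂ s (medium ε m₁ m₂ s) ≤ ε ^ 2 * m₁ ^ 2 * m₂ * Real.log n / 2 ∧
      statZ m₁ m₂ s (light ε m₁ m₂ s) ≤ Cγ * m₁ ^ (3 / 2 : ℝ) * m₂ then
    Verdict.accept
  else
    Verdict.reject

/-- The sample size `max {n / (√m₁ ε²), √n / ε²}` for the second distribution. -/
def rateQ (n : ℕ) (ε m₁ : ℝ) : ℝ :=
  max ((n : ℝ) / (Real.sqrt m₁ * ε ^ 2)) (Real.sqrt n / ε ^ 2)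

end

end ClosenessTesting

namespace ClosenessTesting

open MeasureTheory ProbabilityTheory

/-! Poissonization makes all counts independent: `X_i` is Poisson with mean `m₁ p_i` and `Y_i` with
mean `m₂ q_i`, in each of the two batches (`dataProb_counts_preimage`). The sets `B`, `M`, `H`
depend on the first batches only, so, given these, the statistics are sums of independent terms over
fixed sets. Everything reduces to Markov, Chebyshev and union bounds over a few bad events.

The summand of `W` and `Z` is a combination of the falling factorials `x(x-1)`, `xy`, `y(y-1)`. The
Stein identity therefore gives its mean `m₁² m₂² (p_i - q_i)²` for `W`, and the same multiplied by
`E[1/(S+2)]`, with `S` Poisson of mean `m₁ p_i + m₂ q_i`, for `Z`; the second moments follow the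
same way. The decisive estimate is `integral_centeredSq_div_sq_le`: the variance of a `Z` term is at
most a multiple of its mean plus a noise term whose sum over `i` is of order `m₁³ m₂²`, the square
of the threshold for `Z`.

If `p = q`, the means of `W` and `Z` vanish, `R` has mean at most `m₂² / (2 m₁)`, and `V` over `B`
is bounded by the deviations of the frequencies from their means (`measureReal_heavy_deviation_le`).
The first test rarely fires: an `i` with `m₁ p_i` below twice the threshold is unlikely to have `Y_i
≥ 3`, and a larger one is unlikely to have so small an `X_i` (`measureReal_exists_three_le`). Here
the exponent `8/9 + γ` enters: at `8/9` the threshold is only bounded below by a constant, and the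
extra power beats the union bound over `n` elements.

If `‖p - q‖₁ ≥ ε`, one of `B`, `M`, `H` carries at least `ε/3` of the distance. On `B` the triangle
inequality makes `V` large. On `M` Cauchy–Schwarz with `|M| ≤ 25/b'` makes the mean of `W` at least
twice its threshold. On `H` weighted Cauchy–Schwarz with weights `m₁ p_i + m₂ q_i + 2`, of total at
most `2n + m₁ + m₂`, does the same for `Z`. Chebyshev concludes in the last two cases. Rejection
thus comes from `V`, `W`, `Z` alone; the other two tests only have to be harmless when `p = q`. -/

/-! ### Poissonization: from lists of samples to independent Poisson counts. -/

lemma iidDraws_succ_map_count {n : ℕ} (p : PMF (Fin n)) (N : ℕ) :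
    (iidDraws p (N + 1)).map (fun l i => l.count i) =
      p.bind fun j => ((iidDraws p N).map (fun l i => l.count i)).map
        (fun x : Fin n → ℕ => x + Pi.single j 1) := by
  simp only [iidDraws, PMF.map_bind, PMF.map_comp]
  congr 1
  funext j
  congr 1
  funext l i
  simp only [Function.comp, Pi.add_apply, List.count_cons, Pi.single_apply]
  by_cases h : i = j
  · simp [h]
  · simp [h, Ne.symm h]

/-- Multiplying by the factorials keeps the multinomial recursion free of division in `ℝ≥0∞`. The
subtraction is truncated, which does no harm: for `x j = 0` both sides vanish. -/
lemma map_add_single_mul_factorial {n : ℕ} (g : PMF (Fin n → ℕ)) (j : Fin n) (x : Fin n → ℕ) :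
    (g.map (fun y : Fin n → ℕ => y + Pi.single j 1)) x * ∏ i, ((x i).factorial : ℝ≥0∞) =
      x j * (g (x - Pi.single j 1) * ∏ i, (((x - Pi.single j 1 : Fin n → ℕ) i).factorial : ℝ≥0∞)) := by
  rcases Nat.eq_zero_or_pos (x j) with hj | hj
  · have : (g.map (fun y : Fin n → ℕ => y + Pi.single j 1)) x = 0 := by
      rw [PMF.apply_eq_zero_iff, PMF.mem_support_map_iff]
      rintro ⟨y, -, rfl⟩
      simp at hj
    rw [this, hj]; simp
  · have hx : (x - Pi.single j 1) + Pi.single j 1 = x := by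
      funext i
      by_cases h : i = j
      · subst h; simp; omega
      · simp [h]
    have h1 : (g.map (fun y : Fin n → ℕ => y + Pi.single j 1)) x = g (x - Pi.single j 1) := by
      rw [PMF.map_apply]
      rw [tsum_eq_single (x - Pi.single j 1)]
      · rw [if_pos hx.symm]
      · intro y hy
        rw [if_neg]
        rintro rfl
        apply hy
        funext i; simp
    rw [h1, ← Finset.mul_prod_erase Finset.univ (fun i => ((x i).factorial : ℝ≥0∞)) (Finset.mem_univ j),
      ← Finset.mul_prod_erase Finset.univ _ (Finset.mem_univ j)]
    have h2 : ∏ i ∈ Finset.univ.erase j, (((x - Pi.single j 1 : Fin n → ℕ) i).factorial : ℝ≥0∞)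
        = ∏ i ∈ Finset.univ.erase j, ((x i).factorial : ℝ≥0∞) := by
      refine Finset.prod_congr rfl fun i hi => ?_
      simp [Finset.ne_of_mem_erase hi]
    rw [h2]
    have h3 : ((x j).factorial : ℝ≥0∞) = x j * (((x - Pi.single j 1 : Fin n → ℕ) j).factorial : ℝ≥0∞) := by
      simp only [Pi.sub_apply, Pi.single_eq_same]
      exact_mod_cast (Nat.mul_factorial_pred hj.ne').symm
    rw [h3]; ring

/-- The counts of `N` independent draws are multinomial. -/
lemma iidDraws_map_count_mul_factorial {n : ℕ} (p : PMF (Fin n)) (N : ℕ) (x : Fin n → ℕ) :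
    ((iidDraws p N).map (fun l i => l.count i)) x * ∏ i, ((x i).factorial : ℝ≥0∞) =
      if ∑ i, x i = N then (N.factorial : ℝ≥0∞) * ∏ i, p i ^ x i else 0 := by
  induction N generalizing x with
  | zero =>
    simp only [iidDraws, PMF.pure_map, PMF.pure_apply]
    have h0 : (fun i : Fin n => List.count i []) = 0 := by funext i; simp
    rw [h0]
    by_cases h : x = 0
    · subst h
      simp
    · have h' : ¬ ∑ i, x i = 0 := by
        intro h0
        apply h; funext i
        simpa using (Finset.sum_eq_zero_iff.1 h0) i (Finset.mem_univ i)
      simp [h', h]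
  | succ N ih =>
    rw [iidDraws_succ_map_count, PMF.bind_apply, tsum_fintype, Finset.sum_mul]
    simp_rw [mul_assoc, map_add_single_mul_factorial, ih]
    -- The first draw `j` contributes `x j` times a quantity independent of `j`; summing over `j`
    -- produces the factor `∑ x j = N + 1` of the new factorial.
    have key : ∀ j : Fin n, p j * (x j * (if ∑ i, (x - Pi.single j 1 : Fin n → ℕ) i = N then
        (N.factorial : ℝ≥0∞) * ∏ i, p i ^ (x - Pi.single j 1 : Fin n → ℕ) i else 0)) =
        x j * (if ∑ i, x i = N + 1 then (N.factorial : ℝ≥0∞) * ∏ i, p i ^ x i else 0) := by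
      intro j
      rcases Nat.eq_zero_or_pos (x j) with hj | hj
      · simp [hj]
      · have hs : ∑ i, x i = ∑ i, (x - Pi.single j 1 : Fin n → ℕ) i + 1 := by
          rw [← Finset.add_sum_erase _ _ (Finset.mem_univ j),
            ← Finset.add_sum_erase _ (x - Pi.single j 1 : Fin n → ℕ) (Finset.mem_univ j)]
          have : ∑ i ∈ Finset.univ.erase j, (x - Pi.single j 1 : Fin n → ℕ) i =
              ∑ i ∈ Finset.univ.erase j, x i := by
            refine Finset.sum_congr rfl fun i hi => ?_
            simp [Finset.ne_of_mem_erase hi]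
          rw [this]; simp; omega
        have hp : ∏ i, p i ^ x i = p j * ∏ i, p i ^ (x - Pi.single j 1 : Fin n → ℕ) i := by
          have e : ∏ i ∈ Finset.univ.erase j, p i ^ (x - Pi.single j 1 : Fin n → ℕ) i =
              ∏ i ∈ Finset.univ.erase j, p i ^ x i := by
            refine Finset.prod_congr rfl fun i hi => ?_
            simp [Finset.ne_of_mem_erase hi]
          have e1 := Finset.mul_prod_erase Finset.univ (fun i => p i ^ x i) (Finset.mem_univ j)
          have e2 := Finset.mul_prod_erase Finset.univ
            (fun i => p i ^ (x - Pi.single j 1 : Fin n → ℕ) i) (Finset.mem_univ j)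
          rw [← e1, ← e2, e, ← mul_assoc, ← pow_succ']
          congr 2
          simp; omega
        rw [hs, hp]
        simp only [add_left_inj]
        split_ifs
        · ring
        · simp
    simp_rw [key]
    rw [← Finset.sum_mul, ← Nat.cast_sum]
    split_ifs with h
    · rw [h, Nat.factorial_succ]; push_cast; ring
    · simp

/-- The counts of `Pois(m)` samples are independent Poisson variables. -/
lemma poissonSample_map_count {n : ℕ} {m : ℝ} (hm : 0 ≤ m) (p : PMF (Fin n)) :
    (poissonSample m p).map (fun l i => l.count i) =
      (Measure.pi fun i => poissonMeasure (m.toNNReal * (p i).toNNReal)).toPMF := by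
  ext x
  rw [Measure.toPMF_apply, Measure.pi_singleton]
  simp_rw [poissonMeasure_singleton]
  rw [poissonSample, PMF.map_bind, PMF.bind_apply]
  have hfac : ∀ i, ((x i).factorial : ℝ≥0∞) ≠ 0 := fun i => by
    exact_mod_cast (Nat.factorial_pos _).ne'
  have hf0 : ∏ i, ((x i).factorial : ℝ≥0∞) ≠ 0 := Finset.prod_ne_zero_iff.2 fun i _ => hfac i
  have hft : ∏ i, ((x i).factorial : ℝ≥0∞) ≠ ∞ :=
    ENNReal.prod_ne_top fun i _ => ENNReal.natCast_ne_top _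
  rw [← ENNReal.mul_left_inj hf0 hft, ← ENNReal.tsum_mul_right]
  simp_rw [mul_assoc, iidDraws_map_count_mul_factorial]
  -- The count vector determines the sample size, so one value of `N` survives; `∑ p i = 1` then
  -- splits `exp (-m)` into the factors of the product law.
  rw [tsum_eq_single (∑ i, x i)]
  · rw [if_pos rfl, Measure.toPMF_apply, poissonMeasure_singleton, ← Finset.prod_mul_distrib]
    have hp : ∏ i, p i ^ x i = ENNReal.ofReal (∏ i, (p i).toReal ^ x i) := by
      rw [ENNReal.ofReal_prod_of_nonneg (fun i _ => by positivity)]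
      refine Finset.prod_congr rfl fun i _ => ?_
      rw [ENNReal.ofReal_pow ENNReal.toReal_nonneg, ENNReal.ofReal_toReal (PMF.apply_ne_top p i)]
    have hs : ∑ i, (p i).toReal = 1 := by
      rw [← ENNReal.toReal_sum fun i _ => PMF.apply_ne_top p i]
      have := p.tsum_coe
      rw [tsum_fintype] at this
      rw [this]; simp
    have h1 : ∀ i, ENNReal.ofReal (Real.exp (-((m.toNNReal * (p i).toNNReal : ℝ≥0) : ℝ)) *
        ((m.toNNReal * (p i).toNNReal : ℝ≥0) : ℝ) ^ x i / (x i).factorial) * ((x i).factorial : ℝ≥0∞)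
        = ENNReal.ofReal (Real.exp (-(m * (p i).toReal)) * (m * (p i).toReal) ^ x i) := by
      intro i
      rw [← ENNReal.ofReal_natCast, ← ENNReal.ofReal_mul (by positivity)]
      congr 1
      have : ((x i).factorial : ℝ) ≠ 0 := by positivity
      rw [div_mul_cancel₀ _ this]
      push_cast
      rw [Real.coe_toNNReal _ hm]
    simp_rw [h1]
    rw [← ENNReal.ofReal_prod_of_nonneg (fun i _ => by positivity)]
    rw [hp, ← ENNReal.ofReal_natCast,
      ← ENNReal.ofReal_mul (by positivity), ← ENNReal.ofReal_mul (by positivity)]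
    congr 1
    rw [Real.coe_toNNReal _ hm]
    simp_rw [mul_pow]
    rw [Finset.prod_mul_distrib, Finset.prod_mul_distrib, Finset.prod_pow_eq_pow_sum,
      ← Real.exp_sum, Finset.sum_neg_distrib, ← Finset.mul_sum, hs]
    have : ((∑ i, x i).factorial : ℝ) ≠ 0 := by positivity
    field_simp
  · intro N hN
    rw [if_neg hN.symm]; simp

/-- The pairs of counts of the two distributions, as independent Poisson variables. -/
noncomputable def countMeasure {n : ℕ} (p q : PMF (Fin n)) (m₁ m₂ : ℝ) :
    Measure (Fin n → ℕ × ℕ) :=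
  Measure.pi fun i => (poissonMeasure (m₁.toNNReal * (p i).toNNReal)).prod
    (poissonMeasure (m₂.toNNReal * (q i).toNNReal))

instance {n : ℕ} (p q : PMF (Fin n)) (m₁ m₂ : ℝ) :
    IsProbabilityMeasure (countMeasure p q m₁ m₂) := by
  unfold countMeasure; infer_instance

/-- The counts of the first and of the second batches. -/
def Samples.counts {n : ℕ} (s : Samples n) : (Fin n → ℕ × ℕ) × (Fin n → ℕ × ℕ) :=
  (fun i => (s.S₁.count i, s.T₁.count i), fun i => (s.S₂.count i, s.T₂.count i))

/-- All spaces of counts are countable, so every set is measurable and the two laws need only be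
compared on points. From here on the tester is analysed under the product measure. -/
lemma dataProb_counts_preimage {n : ℕ} (p q : PMF (Fin n)) {m₁ m₂ : ℝ} (h₁ : 0 ≤ m₁)
    (h₂ : 0 ≤ m₂) (A : Set ((Fin n → ℕ × ℕ) × (Fin n → ℕ × ℕ))) :
    dataProb p q m₁ m₂ {s | s.counts ∈ A} =
      ((countMeasure p q m₁ m₂).prod (countMeasure p q m₁ m₂)) A := by
  have hmap : (samplesLaw p q m₁ m₂).map Samples.counts =
      ((countMeasure p q m₁ m₂).prod (countMeasure p q m₁ m₂)).toPMF := by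
    set c : List (Fin n) → Fin n → ℕ := fun l i => l.count i with hc
    have e1 : (samplesLaw p q m₁ m₂).map Samples.counts =
        ((poissonSample m₁ p).map c).bind fun a => ((poissonSample m₁ p).map c).bind fun a' =>
        ((poissonSample m₂ q).map c).bind fun d => ((poissonSample m₂ q).map c).bind fun d' =>
          PMF.pure (fun i => (a i, d i), fun i => (a' i, d' i)) := by
      simp only [samplesLaw, PMF.map_bind, PMF.bind_map, PMF.pure_map]
      rfl
    rw [e1, hc, poissonSample_map_count h₁, poissonSample_map_count h₂]
    ext ⟨z, w⟩
    rw [Measure.toPMF_apply, ← Set.singleton_prod_singleton, Measure.prod_prod]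
    simp only [countMeasure, Measure.pi_singleton]
    have h3 : ∀ v : Fin n → ℕ × ℕ, ∀ i, ((poissonMeasure (m₁.toNNReal * (p i).toNNReal)).prod
      (poissonMeasure (m₂.toNNReal * (q i).toNNReal))) {v i} =
        poissonMeasure (m₁.toNNReal * (p i).toNNReal) {(v i).1} *
        poissonMeasure (m₂.toNNReal * (q i).toNNReal) {(v i).2} := by
      intro v i
      rw [← Measure.prod_prod, Set.singleton_prod_singleton]
    simp_rw [h3, Finset.prod_mul_distrib]
    simp only [PMF.bind_apply, PMF.pure_apply, Measure.toPMF_apply, Measure.pi_singleton]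
    rw [tsum_eq_single (fun i => (z i).1), tsum_eq_single (fun i => (w i).1),
      tsum_eq_single (fun i => (z i).2), tsum_eq_single (fun i => (w i).2)]
    · simp; ring
    · intro d' hd'
      rw [if_neg, mul_zero]
      intro h; apply hd'
      simp only [Prod.mk.injEq] at h
      rw [h.2]
    · intro d hd
      convert mul_zero _
      rw [ENNReal.tsum_eq_zero]
      intro d'
      rw [if_neg, mul_zero]
      intro h; apply hd
      simp only [Prod.mk.injEq] at h
      rw [h.1]
    · intro a' ha'
      convert mul_zero _
      rw [ENNReal.tsum_eq_zero]
      intro d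
      convert mul_zero _
      rw [ENNReal.tsum_eq_zero]
      intro d'
      rw [if_neg, mul_zero]
      intro h; apply ha'
      simp only [Prod.mk.injEq] at h
      rw [h.2]
    · intro a ha
      convert mul_zero _
      rw [ENNReal.tsum_eq_zero]
      intro a'
      convert mul_zero _
      rw [ENNReal.tsum_eq_zero]
      intro d
      convert mul_zero _
      rw [ENNReal.tsum_eq_zero]
      intro d'
      rw [if_neg, mul_zero]
      intro h; apply ha
      simp only [Prod.mk.injEq] at h
      rw [h.1]
  have hA : MeasurableSet A := A.to_countable.measurableSet
  have : {s : Samples n | s.counts ∈ A} = Samples.counts ⁻¹' A := rfl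
  rw [dataProb, this, ← PMF.toOuterMeasure_map_apply, hmap,
    ← PMF.toMeasure_apply_eq_toOuterMeasure_apply _ hA, Measure.toPMF_toMeasure]

/-! ### Poisson factorial moments and the moments of the centered square. -/

/-- `f` is integrable with integral `v`. -/
def HasIntegral {Ω : Type*} [MeasurableSpace Ω] (ν : Measure Ω) (f : Ω → ℝ) (v : ℝ) : Prop :=
  Integrable f ν ∧ ∫ x, f x ∂ν = v

namespace HasIntegral

variable {Ω : Type*} [MeasurableSpace Ω] {ν : Measure Ω} {f g : Ω → ℝ} {v w : ℝ}

lemma add (hf : HasIntegral ν f v) (hg : HasIntegral ν g w) :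
    HasIntegral ν (fun x => f x + g x) (v + w) :=
  ⟨hf.1.add hg.1, by rw [integral_add hf.1 hg.1, hf.2, hg.2]⟩

lemma sub (hf : HasIntegral ν f v) (hg : HasIntegral ν g w) :
    HasIntegral ν (fun x => f x - g x) (v - w) :=
  ⟨hf.1.sub hg.1, by rw [integral_sub hf.1 hg.1, hf.2, hg.2]⟩

lemma const_mul (c : ℝ) (hf : HasIntegral ν f v) : HasIntegral ν (fun x => c * f x) (c * v) :=
  ⟨hf.1.const_mul c, by rw [integral_const_mul, hf.2]⟩

lemma const [IsProbabilityMeasure ν] (c : ℝ) : HasIntegral ν (fun _ => c) c :=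
  ⟨integrable_const c, by simp⟩

lemma mono (hf : HasIntegral ν f v) (hg : HasIntegral ν g w) (h : ∀ x, f x ≤ g x) : v ≤ w := by
  rw [← hf.2, ← hg.2]; exact integral_mono hf.1 hg.1 h

lemma congr' (hf : HasIntegral ν f v) (h : ∀ x, g x = f x) (hv : w = v) : HasIntegral ν g w := by
  have : g = f := funext h
  rw [this, hv]; exact hf

end HasIntegral

lemma integrable_natCast_mul_poissonMeasure {r : ℝ≥0} {g : ℕ → ℝ}
    (hg : Integrable (fun k => g (k + 1)) (poissonMeasure r)) :
    Integrable (fun k : ℕ => (k : ℝ) * g k) (poissonMeasure r) := by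
  rw [integrable_poissonMeasure_iff] at hg ⊢
  rw [← summable_nat_add_iff 1]
  refine (hg.mul_left (r : ℝ)).congr fun k => ?_
  rw [Nat.factorial_succ, norm_mul]
  have h1 : (k.factorial : ℝ) ≠ 0 := by positivity
  have h2 : (k : ℝ) + 1 ≠ 0 := by positivity
  have h3 : ‖((k + 1 : ℕ) : ℝ)‖ = (k : ℝ) + 1 := by
    rw [Real.norm_of_nonneg (by positivity)]; push_cast; ring
  rw [h3]; push_cast
  field_simp
  ring

/-- The Stein identity of the Poisson distribution. -/
lemma integral_natCast_mul_poissonMeasure (r : ℝ≥0) (g : ℕ → ℝ) :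
    ∫ k : ℕ, (k : ℝ) * g k ∂poissonMeasure r = r * ∫ k, g (k + 1) ∂poissonMeasure r := by
  rw [integral_poissonMeasure, integral_poissonMeasure, ← tsum_mul_left,
    ← (Nat.succ_injective).tsum_eq]
  · refine tsum_congr fun k => ?_
    have h1 : (k.factorial : ℝ) ≠ 0 := by positivity
    have h2 : (k : ℝ) + 1 ≠ 0 := by positivity
    simp only [Nat.succ_eq_add_one, Nat.factorial_succ, smul_eq_mul]; push_cast
    field_simp
    ring
  · intro k hk
    cases k with
    | zero => simp at hk
    | succ k => exact ⟨k, rfl⟩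

lemma cast_descFactorial_succ (k j : ℕ) :
    (k.descFactorial (j + 1) : ℝ) = k * ((k - 1).descFactorial j : ℝ) := by
  cases k with
  | zero => simp
  | succ k => rw [Nat.succ_descFactorial_succ]; simp

lemma integrable_descFactorial_mul_poissonMeasure (r : ℝ≥0) (j : ℕ) {g : ℕ → ℝ}
    (hg : Integrable (fun k => g (k + j)) (poissonMeasure r)) :
    Integrable (fun k : ℕ => (k.descFactorial j : ℝ) * g k) (poissonMeasure r) := by
  induction j generalizing g with
  | zero => simpa using hg
  | succ j ih =>
    have h := @ih (fun k => g (k + 1)) (by simpa [add_assoc, add_comm 1 j] using hg)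
    have h2 := integrable_natCast_mul_poissonMeasure (r := r)
      (g := fun k => ((k - 1).descFactorial j : ℝ) * g k) (by simpa using h)
    refine h2.congr (Filter.Eventually.of_forall fun k => ?_)
    simp only [cast_descFactorial_succ, mul_assoc]

lemma integral_descFactorial_mul_poissonMeasure (r : ℝ≥0) (j : ℕ) (g : ℕ → ℝ) :
    ∫ k : ℕ, (k.descFactorial j : ℝ) * g k ∂poissonMeasure r =
      r ^ j * ∫ k, g (k + j) ∂poissonMeasure r := by
  induction j generalizing g with
  | zero => simp
  | succ j ih =>
    have h := ih (fun k => g (k + 1))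
    have h2 := integral_natCast_mul_poissonMeasure r
      (fun k => ((k - 1).descFactorial j : ℝ) * g k)
    simp only [Nat.add_sub_cancel] at h2
    rw [h] at h2
    simp_rw [cast_descFactorial_succ, mul_assoc]
    rw [h2, pow_succ', mul_assoc]
    simp only [add_assoc]

lemma integrable_of_bounded {Ω : Type*} [MeasurableSpace Ω] [DiscreteMeasurableSpace Ω]
    [Countable Ω] (ν : Measure Ω) [IsFiniteMeasure ν] {f : Ω → ℝ} {C : ℝ} (h : ∀ x, |f x| ≤ C) :
    Integrable f ν :=
  Integrable.of_bound (Measurable.of_discrete.aestronglyMeasurable) C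
    (Filter.Eventually.of_forall h)

/-- Factorial moments of a pair of independent Poisson variables, with a weight depending on
the sum. -/
lemma hasIntegral_descFactorial_prod (l u : ℝ≥0) (j k : ℕ) {w : ℕ → ℝ} {C : ℝ}
    (hw : ∀ s, |w s| ≤ C) :
    HasIntegral ((poissonMeasure l).prod (poissonMeasure u))
      (fun z => (z.1.descFactorial j : ℝ) * (z.2.descFactorial k : ℝ) * w (z.1 + z.2))
      (l ^ j * u ^ k * ∫ s, w (s + (j + k)) ∂poissonMeasure (l + u)) := by
  have hC : 0 ≤ C := (abs_nonneg _).trans (hw 0)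
  have i1 : ∀ (r : ℝ≥0) (j : ℕ),
      Integrable (fun k : ℕ => (k.descFactorial j : ℝ)) (poissonMeasure r) := fun r j => by
    simpa using integrable_descFactorial_mul_poissonMeasure r j (g := fun _ => 1) (by simp)
  have hint : Integrable (fun z : ℕ × ℕ =>
      (z.1.descFactorial j : ℝ) * (z.2.descFactorial k : ℝ) * w (z.1 + z.2))
      ((poissonMeasure l).prod (poissonMeasure u)) := by
    refine (((i1 l j).mul_prod (i1 u k)).mul_const C).mono'
      Measurable.of_discrete.aestronglyMeasurable (Filter.Eventually.of_forall fun z => ?_)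
    rw [norm_mul, Real.norm_of_nonneg (by positivity)]
    exact mul_le_mul_of_nonneg_left (hw _) (by positivity)
  refine ⟨hint, ?_⟩
  rw [integral_prod _ hint]
  simp_rw [mul_assoc, integral_const_mul]
  simp_rw [integral_descFactorial_mul_poissonMeasure u k]
  rw [integral_descFactorial_mul_poissonMeasure l j, integral_const_mul]
  congr 2
  -- After the falling factorials are absorbed as shifts, the weight depends only on the sum of the
  -- two variables, which is again Poisson.
  rw [← poissonMeasure_conv_poissonMeasure, Measure.conv, integral_map (by fun_prop)
    (Measurable.of_discrete.aestronglyMeasurable), integral_prod]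
  · refine integral_congr_ae (Filter.Eventually.of_forall fun x => ?_)
    refine integral_congr_ae (Filter.Eventually.of_forall fun y => ?_)
    simp only; congr 1; ring
  · exact integrable_of_bounded _ (fun _ => hw _)

lemma cast_descFactorial_three (x : ℕ) :
    (x.descFactorial 3 : ℝ) = x * (x - 1) * (x - 2) := by
  rcases x with _ | _ | x
  · simp
  · simp
  · simp only [Nat.succ_descFactorial_succ, Nat.descFactorial_one]; push_cast; ring

lemma cast_descFactorial_four (x : ℕ) :
    (x.descFactorial 4 : ℝ) = x * (x - 1) * (x - 2) * (x - 3) := by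
  rcases x with _ | _ | _ | x
  · simp
  · simp
  · simp
  · simp only [Nat.succ_descFactorial_succ, Nat.descFactorial_one]; push_cast; ring

/-- The summand `(a x - c y)² - (a² x + c² y)` of the statistics. -/
def centeredSq (a c : ℝ) (z : ℕ × ℕ) : ℝ :=
  (a * z.1 - c * z.2) ^ 2 - (a ^ 2 * z.1 + c ^ 2 * z.2)

/-- Subtracting `a² x + c² y` turns the squares into falling factorials: the summand is `a² x(x-1) -
2ac xy + c² y(y-1)`, all of degree two, so the weight is shifted by 2 throughout. -/
lemma hasIntegral_centeredSq (l u : ℝ≥0) (a c : ℝ) {w : ℕ → ℝ} {C : ℝ} (hw : ∀ s, |w s| ≤ C) :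
    HasIntegral ((poissonMeasure l).prod (poissonMeasure u))
      (fun z => centeredSq a c z * w (z.1 + z.2))
      ((a * l - c * u) ^ 2 * ∫ s, w (s + 2) ∂poissonMeasure (l + u)) := by
  have h := fun j k => hasIntegral_descFactorial_prod l u j k hw
  refine ((((h 2 0).const_mul (a ^ 2)).add ((h 1 1).const_mul (-2 * a * c))).add
    ((h 0 2).const_mul (c ^ 2))).congr' (fun z => ?_) ?_
  · simp only [Nat.cast_descFactorial_two, Nat.descFactorial_one, Nat.descFactorial_zero,
      centeredSq, Nat.cast_one]
    ring
  · norm_num; ring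

/-- The square is expanded in mixed falling factorials of total degree 4, 3 and 2 (`h4`, `h3`,
`h2`); the degree is the shift of the weight. -/
lemma hasIntegral_centeredSq_sq (l u : ℝ≥0) (a c : ℝ) {w : ℕ → ℝ} {C : ℝ}
    (hw : ∀ s, |w s| ≤ C) :
    HasIntegral ((poissonMeasure l).prod (poissonMeasure u))
      (fun z => centeredSq a c z ^ 2 * w (z.1 + z.2))
      ((a * l - c * u) ^ 4 * ∫ s, w (s + 4) ∂poissonMeasure (l + u) +
        4 * (a ^ 2 * l + c ^ 2 * u) * (a * l - c * u) ^ 2 *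
          ∫ s, w (s + 3) ∂poissonMeasure (l + u) +
        2 * (a ^ 2 * l + c ^ 2 * u) ^ 2 * ∫ s, w (s + 2) ∂poissonMeasure (l + u)) := by
  have h := fun j k => hasIntegral_descFactorial_prod l u j k hw
  have h4 := ((((h 4 0).const_mul (a ^ 4)).add ((h 3 1).const_mul (-4 * a ^ 3 * c))).add
    (((h 2 2).const_mul (6 * a ^ 2 * c ^ 2)).add ((h 1 3).const_mul (-4 * a * c ^ 3)))).add
    ((h 0 4).const_mul (c ^ 4))
  have h3 := (((h 3 0).const_mul (4 * a ^ 4)).add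
      ((h 2 1).const_mul (4 * (a ^ 2 * c ^ 2 - 2 * a ^ 3 * c)))).add
    (((h 1 2).const_mul (4 * (a ^ 2 * c ^ 2 - 2 * a * c ^ 3))).add ((h 0 3).const_mul (4 * c ^ 4)))
  have h2 := (((h 2 0).const_mul (2 * a ^ 4)).add ((h 1 1).const_mul (4 * a ^ 2 * c ^ 2))).add
    ((h 0 2).const_mul (2 * c ^ 4))
  refine ((h4.add h3).add h2).congr' (fun z => ?_) ?_
  · simp only [Nat.cast_descFactorial_two, Nat.descFactorial_one, Nat.descFactorial_zero,
      centeredSq, Nat.cast_one, cast_descFactorial_three, cast_descFactorial_four]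
    ring
  · norm_num; ring

/-! ### Absolute deviation and tails of the Poisson distribution. -/

lemma hasIntegral_natCast_poissonMeasure (r : ℝ≥0) :
    HasIntegral (poissonMeasure r) (fun k => (k : ℝ)) r := by
  have h1 := integrable_natCast_mul_poissonMeasure (r := r) (g := fun _ => 1) (by simp)
  have h2 := integral_natCast_mul_poissonMeasure r (fun _ => 1)
  simp only [mul_one, integral_const, probReal_univ, smul_eq_mul] at h1 h2
  exact ⟨h1, h2⟩

lemma hasIntegral_sub_sq_poissonMeasure (r : ℝ≥0) :
    HasIntegral (poissonMeasure r) (fun k : ℕ => ((k : ℝ) - r) ^ 2) r := by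
  have h1 := integrable_descFactorial_mul_poissonMeasure r 2 (g := fun _ => 1) (by simp)
  have h2 := integral_descFactorial_mul_poissonMeasure r 2 (fun _ => 1)
  simp only [mul_one, integral_const, probReal_univ, smul_eq_mul] at h1 h2
  have h3 : HasIntegral (poissonMeasure r) (fun k : ℕ => (k.descFactorial 2 : ℝ)) (r ^ 2) :=
    ⟨h1, h2⟩
  refine ((h3.add ((hasIntegral_natCast_poissonMeasure r).const_mul (1 - 2 * r))).add
    (HasIntegral.const ((r : ℝ) ^ 2))).congr' (fun k => ?_) ?_
  · rw [Nat.cast_descFactorial_two]; ring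
  · ring

lemma integrable_abs_sub_poissonMeasure (r : ℝ≥0) :
    Integrable (fun k : ℕ => |(k : ℝ) - r|) (poissonMeasure r) :=
  ((hasIntegral_natCast_poissonMeasure r).sub (HasIntegral.const (r : ℝ))).1.abs

/-- Integrate `t ≤ t² / (2√r) + √r / 2` against the variance `r`, which replaces Cauchy–Schwarz; `r
= 0` is separate because of the division. -/
lemma integral_abs_sub_poissonMeasure_le (r : ℝ≥0) :
    ∫ k : ℕ, |(k : ℝ) - r| ∂poissonMeasure r ≤ Real.sqrt r := by
  rcases eq_or_ne r 0 with rfl | hr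
  · have h := (hasIntegral_natCast_poissonMeasure 0).2
    simpa using h.le
  have hs : 0 < Real.sqrt r := Real.sqrt_pos.2 (by positivity)
  have h := (((hasIntegral_sub_sq_poissonMeasure r).const_mul (1 / (2 * Real.sqrt r))).add
    (HasIntegral.const (Real.sqrt r / 2)))
  have h2 : HasIntegral (poissonMeasure r) (fun k : ℕ => |(k : ℝ) - r|) _ :=
    ⟨integrable_abs_sub_poissonMeasure r, rfl⟩
  refine (h2.mono h fun k => ?_).trans ?_
  · rw [← sq_abs]
    set t := |(k : ℝ) - r|
    rw [← sub_nonneg]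
    have : 1 / (2 * √(r : ℝ)) * t ^ 2 + √(r : ℝ) / 2 - t = (t - √(r : ℝ)) ^ 2 / (2 * √(r : ℝ)) := by
      field_simp; ring
    rw [this]; positivity
  · have : 1 / (2 * √(r : ℝ)) * r = √(r : ℝ) / 2 := by
      have h3 := Real.mul_self_sqrt (show (0 : ℝ) ≤ r from r.2)
      field_simp; linarith
    rw [this]; linarith

/-- Lower tail of the Poisson distribution. -/
lemma poissonMeasure_real_le_half (r : ℝ≥0) {t : ℝ} (ht : t ≤ r / 2) :
    (poissonMeasure r).real {k : ℕ | (k : ℝ) ≤ t} ≤ Real.exp (-(r : ℝ) / 8) := by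
  -- Chernoff bound with `exp (r/2 - k)`, which dominates the indicator of the event. Its mean is
  -- `exp (-r/2 + r/e)`, and `1/e ≤ 3/8` gives the exponent `-r/8`.
  have hsum : HasSum (fun k : ℕ => (Real.exp (-r) * (r : ℝ) ^ k / k.factorial) •
      Real.exp (r / 2 - k)) (Real.exp (-r) * (Real.exp (r / 2) * Real.exp (r * Real.exp (-1)))) := by
    have h := ((NormedSpace.expSeries_div_hasSum_exp ((r : ℝ) * Real.exp (-1))).mul_left
      (Real.exp (r / 2))).mul_left (Real.exp (-r))
    rw [← Real.exp_eq_exp_ℝ] at h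
    refine h.congr_fun fun k => ?_
    have e1 : Real.exp (r / 2 - k) = Real.exp (r / 2) * Real.exp (-1) ^ k := by
      rw [← Real.exp_nat_mul, ← Real.exp_add]; congr 1; ring
    rw [e1, smul_eq_mul, mul_pow]; ring
  have hint : Integrable (fun k : ℕ => Real.exp (r / 2 - k)) (poissonMeasure r) := by
    rw [integrable_poissonMeasure_iff]
    simpa [Real.norm_of_nonneg (Real.exp_nonneg _)] using hsum.summable
  have h2 : ∫ k : ℕ, Real.exp (r / 2 - k) ∂poissonMeasure r =
      Real.exp (-r) * (Real.exp (r / 2) * Real.exp (r * Real.exp (-1))) := by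
    rw [integral_poissonMeasure]; exact hsum.tsum_eq
  have h3 : (poissonMeasure r).real {k : ℕ | (k : ℝ) ≤ t} ≤
      ∫ k : ℕ, Real.exp (r / 2 - k) ∂poissonMeasure r := by
    rw [← integral_indicator_one (MeasurableSet.of_discrete)]
    refine integral_mono ((integrable_const (1 : ℝ)).indicator MeasurableSet.of_discrete) hint
      fun k => ?_
    by_cases hk : (k : ℝ) ≤ t
    · rw [Set.indicator_of_mem (by exact hk)]
      exact Real.one_le_exp (by linarith)
    · rw [Set.indicator_of_notMem (by exact hk)]
      exact Real.exp_nonneg _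
  refine h3.trans ?_
  rw [h2, ← Real.exp_add, ← Real.exp_add]
  apply Real.exp_le_exp.2
  have he : Real.exp (-1) ≤ 3 / 8 := by
    rw [Real.exp_neg, inv_le_comm₀ (Real.exp_pos _) (by norm_num)]
    have := Real.exp_one_gt_d9
    norm_num; linarith
  have := mul_le_mul_of_nonneg_left he r.2
  simp only [NNReal.val_eq_coe] at this
  linarith

lemma poissonMeasure_real_three_le (r : ℝ≥0) :
    (poissonMeasure r).real {k : ℕ | 3 ≤ k} ≤ (r : ℝ) ^ 3 := by
  have h1 := integrable_descFactorial_mul_poissonMeasure r 3 (g := fun _ => 1) (by simp)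
  have h2 := integral_descFactorial_mul_poissonMeasure r 3 (fun _ => 1)
  simp only [mul_one, integral_const, probReal_univ, smul_eq_mul] at h1 h2
  rw [← h2, ← integral_indicator_one (MeasurableSet.of_discrete)]
  refine integral_mono ((integrable_const (1 : ℝ)).indicator MeasurableSet.of_discrete) h1
    fun k => ?_
  by_cases hk : 3 ≤ k
  · rw [Set.indicator_of_mem (by exact hk)]
    have : 0 < k.descFactorial 3 := Nat.descFactorial_pos.2 hk
    simp only [Pi.one_apply]
    exact_mod_cast this
  · rw [Set.indicator_of_notMem (by exact hk)]
    positivity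

lemma integral_indicator_two_poissonMeasure_le (r : ℝ≥0) :
    ∫ k : ℕ, (if k = 2 then (1 : ℝ) else 0) ∂poissonMeasure r ≤ (r : ℝ) ^ 2 / 2 := by
  have h1 := integrable_descFactorial_mul_poissonMeasure r 2 (g := fun _ => 1) (by simp)
  have h2 := integral_descFactorial_mul_poissonMeasure r 2 (fun _ => 1)
  simp only [mul_one, integral_const, probReal_univ, smul_eq_mul] at h1 h2
  have h3 : HasIntegral (poissonMeasure r) (fun k : ℕ => (k.descFactorial 2 : ℝ)) (r ^ 2) :=
    ⟨h1, h2⟩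
  have h4 : HasIntegral (poissonMeasure r) (fun k : ℕ => if k = 2 then (1 : ℝ) else 0) _ :=
    ⟨integrable_of_bounded _ (C := 1) (fun k => by split_ifs <;> simp), rfl⟩
  refine (h4.mono (h3.const_mul (1 / 2)) fun k => ?_).trans (by linarith)
  split_ifs with hk
  · subst hk; norm_num [Nat.descFactorial]
  · positivity

/-- By the Stein identity with `g k = 1/k` the left side is the mean of `k · (1/k)`, which is 0 at
`k = 0` and 1 elsewhere. -/
lemma mul_integral_inv_succ_poissonMeasure_le (r : ℝ≥0) :
    (r : ℝ) * ∫ k : ℕ, 1 / ((k : ℝ) + 1) ∂poissonMeasure r ≤ 1 := by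
  have h := integral_natCast_mul_poissonMeasure r (fun k => 1 / (k : ℝ))
  push_cast at h
  rw [← h]
  have b : ∀ k : ℕ, (k : ℝ) * (1 / (k : ℝ)) ≤ 1 := fun k => by
    rw [mul_one_div]; exact div_self_le_one _
  have h2 : HasIntegral (poissonMeasure r) (fun k : ℕ => (k : ℝ) * (1 / (k : ℝ))) _ :=
    ⟨integrable_of_bounded _ (C := 1) (fun k => by
      rw [abs_of_nonneg (by positivity)]; exact b k), rfl⟩
  exact h2.mono (HasIntegral.const 1) b

/-! ### Inverse moments and the second moment of a summand of `Z`. -/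

section Inverse

lemma integrable_inv_add_pow (r : ℝ≥0) (j k : ℕ) :
    Integrable (fun s : ℕ => (((s + j : ℕ) : ℝ)⁻¹) ^ k) (poissonMeasure r) :=
  integrable_of_bounded _ (C := 1) fun s => by
    rw [abs_of_nonneg (by positivity)]
    exact pow_le_one₀ (by positivity) (Nat.cast_inv_le_one _)

/-- Jensen for the convex function `1/x`: integrate its tangent line at `r + 2`. -/
lemma one_div_le_integral_inv_add_two (r : ℝ≥0) :
    1 / ((r : ℝ) + 2) ≤ ∫ s : ℕ, ((s + 2 : ℕ) : ℝ)⁻¹ ∂poissonMeasure r := by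
  have hr : (0 : ℝ) < r + 2 := by positivity
  have h1 := (HasIntegral.const (ν := poissonMeasure r) (2 / ((r : ℝ) + 2))).sub
    (((hasIntegral_natCast_poissonMeasure r).add (HasIntegral.const 2)).const_mul
      (1 / ((r : ℝ) + 2) ^ 2))
  have h2 : HasIntegral (poissonMeasure r) (fun s : ℕ => ((s + 2 : ℕ) : ℝ)⁻¹) _ :=
    ⟨by simpa using integrable_inv_add_pow r 2 1, rfl⟩
  refine le_trans (le_of_eq ?_) (h1.mono h2 fun s => ?_)
  · field_simp; ring
  · push_cast
    have hs : (0 : ℝ) < s + 2 := by positivity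
    rw [← sub_nonneg]
    have : ((s : ℝ) + 2)⁻¹ - (2 / ((r : ℝ) + 2) - 1 / ((r : ℝ) + 2) ^ 2 * (s + 2)) =
        ((s : ℝ) - r) ^ 2 / ((s + 2) * (r + 2) ^ 2) := by
      field_simp; ring
    rw [this]; positivity

/-- The Stein identity trades the factor `r` for `s` and lowers the shift by one; then `s / (s+2)² ≤
1 / (s+2)`. The next two bounds use the same exchange. -/
lemma mul_integral_inv_add_three_sq_le (r : ℝ≥0) :
    (r : ℝ) * ∫ s : ℕ, (((s + 3 : ℕ) : ℝ)⁻¹) ^ 2 ∂poissonMeasure r ≤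
      ∫ s : ℕ, ((s + 2 : ℕ) : ℝ)⁻¹ ∂poissonMeasure r := by
  have h := integral_natCast_mul_poissonMeasure r (fun k => (((k + 2 : ℕ) : ℝ)⁻¹) ^ 2)
  simp only [add_assoc] at h
  norm_num only at h
  rw [← h]
  refine HasIntegral.mono ⟨?_, rfl⟩ ⟨by simpa using integrable_inv_add_pow r 2 1, rfl⟩ fun s => ?_
  · exact integrable_natCast_mul_poissonMeasure (integrable_inv_add_pow r 3 2)
  · push_cast
    have hs : (0 : ℝ) < s + 2 := by positivity
    rw [inv_pow, ← div_eq_mul_inv, inv_eq_one_div, div_le_div_iff₀ (by positivity) hs]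
    nlinarith

lemma sq_mul_integral_inv_add_four_sq_le (r : ℝ≥0) :
    (r : ℝ) ^ 2 * ∫ s : ℕ, (((s + 4 : ℕ) : ℝ)⁻¹) ^ 2 ∂poissonMeasure r ≤ 1 := by
  have h := integral_descFactorial_mul_poissonMeasure r 2 (fun k => (((k + 2 : ℕ) : ℝ)⁻¹) ^ 2)
  simp only [add_assoc] at h
  norm_num only at h
  rw [← h]
  refine HasIntegral.mono ⟨?_, rfl⟩ (HasIntegral.const 1) fun s => ?_
  · exact integrable_descFactorial_mul_poissonMeasure r 2 (integrable_inv_add_pow r 4 2)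
  · rw [Nat.cast_descFactorial_two]; push_cast
    have hs : (0 : ℝ) < s + 2 := by positivity
    rw [inv_pow, ← div_eq_mul_inv, div_le_one (by positivity)]
    nlinarith

lemma mul_integral_inv_add_two_sq_le (r : ℝ≥0) :
    (r : ℝ) * ∫ s : ℕ, (((s + 2 : ℕ) : ℝ)⁻¹) ^ 2 ∂poissonMeasure r ≤ 1 := by
  have h := integral_natCast_mul_poissonMeasure r (fun k => (((k + 1 : ℕ) : ℝ)⁻¹) ^ 2)
  simp only [add_assoc] at h
  norm_num only at h
  rw [← h]
  refine HasIntegral.mono ⟨?_, rfl⟩ (HasIntegral.const 1) fun s => ?_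
  · exact integrable_natCast_mul_poissonMeasure (integrable_inv_add_pow r 2 2)
  · push_cast
    have hs : (0 : ℝ) < s + 1 := by positivity
    rw [inv_pow, ← div_eq_mul_inv, div_le_one (by positivity)]
    nlinarith

lemma integral_inv_add_two_sq_le (r : ℝ≥0) :
    ∫ s : ℕ, (((s + 2 : ℕ) : ℝ)⁻¹) ^ 2 ∂poissonMeasure r ≤
      1 / 2 * ∫ s : ℕ, ((s + 2 : ℕ) : ℝ)⁻¹ ∂poissonMeasure r := by
  refine HasIntegral.mono ⟨integrable_inv_add_pow r 2 2, rfl⟩ (HasIntegral.const_mul _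
    ⟨by simpa using integrable_inv_add_pow r 2 1, rfl⟩) fun s => ?_
  rw [sq]
  refine mul_le_mul_of_nonneg_right ?_ (by positivity)
  push_cast
  rw [inv_le_comm₀ (by positivity) (by norm_num)]
  norm_num

end Inverse

/-- The weight is `s⁻¹`, whose default value 0 at `s = 0` agrees with the convention for empty terms
of `Z`. -/
lemma hasIntegral_centeredSq_div (l u : ℝ≥0) (a c : ℝ) :
    HasIntegral ((poissonMeasure l).prod (poissonMeasure u))
      (fun z => centeredSq a c z / ((z.1 : ℝ) + z.2))
      ((a * l - c * u) ^ 2 * ∫ s : ℕ, ((s + 2 : ℕ) : ℝ)⁻¹ ∂poissonMeasure (l + u)) := by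
  refine (hasIntegral_centeredSq l u a c (w := fun s => (s : ℝ)⁻¹) (C := 1) fun s => ?_).congr'
    (fun z => ?_) rfl
  · rw [abs_of_nonneg (by positivity)]; exact Nat.cast_inv_le_one _
  · push_cast; rfl

/-- This is the variance bound for `Z`. The degree 4, 3 and 2 parts of the second moment contribute
4, 4 and 2 to the constant 10, and only the degree 2 part leaves noise that does not vanish with the
mean. -/
lemma integral_centeredSq_div_sq_le (l u : ℝ≥0) {a c : ℝ} (ha : 0 ≤ a) (hc : 0 ≤ c) :
    Integrable (fun z : ℕ × ℕ => (centeredSq a c z / ((z.1 : ℝ) + z.2)) ^ 2)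
        ((poissonMeasure l).prod (poissonMeasure u)) ∧
      ∫ z : ℕ × ℕ, (centeredSq a c z / ((z.1 : ℝ) + z.2)) ^ 2
          ∂(poissonMeasure l).prod (poissonMeasure u) ≤
        ((a * l - c * u) ^ 2 * ∫ s : ℕ, ((s + 2 : ℕ) : ℝ)⁻¹ ∂poissonMeasure (l + u)) ^ 2 +
        10 * (a + c) ^ 2 *
          ((a * l - c * u) ^ 2 * ∫ s : ℕ, ((s + 2 : ℕ) : ℝ)⁻¹ ∂poissonMeasure (l + u)) +
        4 * (a + c) ^ 2 * a ^ 2 * l := by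
  have h := (hasIntegral_centeredSq_sq l u a c (w := fun s => ((s : ℝ)⁻¹) ^ 2) (C := 1)
    fun s => ?_).congr' (g := fun z : ℕ × ℕ => (centeredSq a c z / ((z.1 : ℝ) + z.2)) ^ 2)
    (fun z => ?_) rfl
  · refine ⟨h.1, h.2.trans_le ?_⟩
    have i1 := one_div_le_integral_inv_add_two (l + u)
    have i2 := mul_integral_inv_add_three_sq_le (l + u)
    have i3 := sq_mul_integral_inv_add_four_sq_le (l + u)
    have i4 := mul_integral_inv_add_two_sq_le (l + u)
    have i5 := integral_inv_add_two_sq_le (l + u)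
    have n2 : 0 ≤ ∫ s : ℕ, (((s + 2 : ℕ) : ℝ)⁻¹) ^ 2 ∂poissonMeasure (l + u) :=
      integral_nonneg fun s => by positivity
    have n3 : 0 ≤ ∫ s : ℕ, (((s + 3 : ℕ) : ℝ)⁻¹) ^ 2 ∂poissonMeasure (l + u) :=
      integral_nonneg fun s => by positivity
    have n4 : 0 ≤ ∫ s : ℕ, (((s + 4 : ℕ) : ℝ)⁻¹) ^ 2 ∂poissonMeasure (l + u) :=
      integral_nonneg fun s => by positivity
    set e := ∫ s : ℕ, ((s + 2 : ℕ) : ℝ)⁻¹ ∂poissonMeasure (l + u)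
    set J2 := ∫ s : ℕ, (((s + 2 : ℕ) : ℝ)⁻¹) ^ 2 ∂poissonMeasure (l + u)
    set J3 := ∫ s : ℕ, (((s + 3 : ℕ) : ℝ)⁻¹) ^ 2 ∂poissonMeasure (l + u)
    set J4 := ∫ s : ℕ, (((s + 4 : ℕ) : ℝ)⁻¹) ^ 2 ∂poissonMeasure (l + u)
    have hl : (0 : ℝ) ≤ l := l.2
    have hu : (0 : ℝ) ≤ u := u.2
    push_cast at i1 i2 i3 i4
    generalize (l : ℝ) = x at *
    generalize (u : ℝ) = y at *
    set D := a * x - c * y with hD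
    set T := a + c with hT
    have hT0 : 0 ≤ T := by positivity
    have hL0 : 0 ≤ x + y := by positivity
    have he : 0 ≤ e := le_trans (by positivity) i1
    have hDT : D ^ 2 ≤ T ^ 2 * (x + y) ^ 2 := by
      rw [← mul_pow]
      apply sq_le_sq'
      · rw [hD, hT]; nlinarith [mul_nonneg ha hl, mul_nonneg ha hu, mul_nonneg hc hl]
      · rw [hD, hT]; nlinarith [mul_nonneg ha hu, mul_nonneg hc hl, mul_nonneg hc hu]
    have t4 : D ^ 4 * J4 ≤ (D ^ 2 * e) ^ 2 + 4 * T ^ 2 * (D ^ 2 * e) := by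
      -- With `r = x + y`, one has `r² J4 ≤ 1` while Jensen gives `r² e² ≥ (r/(r+2))²`; the gap is
      -- at most `4/(r+2) ≤ 4e`. So the degree 4 part exceeds the squared mean by little.
      have k1 : (x + y) ^ 2 * (J4 - e ^ 2) ≤ 4 * e := by
        have k2 : (x + y) ^ 2 / (x + y + 2) ^ 2 ≤ (x + y) ^ 2 * e ^ 2 := by
          rw [div_eq_mul_one_div, ← one_div_pow]
          gcongr
        have k3 : 1 - (x + y) ^ 2 / (x + y + 2) ^ 2 ≤ 4 * (1 / (x + y + 2)) := by
          have : (0 : ℝ) < x + y + 2 := by positivity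
          rw [← sub_nonneg]
          have e1 : 4 * (1 / (x + y + 2)) - (1 - (x + y) ^ 2 / (x + y + 2) ^ 2) =
            4 / (x + y + 2) ^ 2 := by field_simp; ring
          rw [e1]; positivity
        linarith
      rcases le_total J4 (e ^ 2) with hJ | hJ
      · have : D ^ 4 * J4 ≤ D ^ 4 * e ^ 2 := mul_le_mul_of_nonneg_left hJ (by positivity)
        have : 0 ≤ 4 * T ^ 2 * (D ^ 2 * e) := by positivity
        linarith
      · have k4 : D ^ 2 * (J4 - e ^ 2) ≤ T ^ 2 * (4 * e) := by
          calc D ^ 2 * (J4 - e ^ 2) ≤ T ^ 2 * (x + y) ^ 2 * (J4 - e ^ 2) :=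
                mul_le_mul_of_nonneg_right hDT (by linarith)
            _ = T ^ 2 * ((x + y) ^ 2 * (J4 - e ^ 2)) := by ring
            _ ≤ _ := mul_le_mul_of_nonneg_left k1 (by positivity)
        have k5 := mul_le_mul_of_nonneg_left k4 (show 0 ≤ D ^ 2 by positivity)
        linarith
    have t3 : 4 * (a ^ 2 * x + c ^ 2 * y) * D ^ 2 * J3 ≤ 4 * T ^ 2 * (D ^ 2 * e) := by
      have k1 : a ^ 2 * x + c ^ 2 * y ≤ T ^ 2 * (x + y) := by
        have : a ^ 2 ≤ T ^ 2 := by rw [hT]; gcongr; linarith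
        have : c ^ 2 ≤ T ^ 2 := by rw [hT]; gcongr; linarith
        have := mul_le_mul_of_nonneg_right ‹a ^ 2 ≤ T ^ 2› hl
        have := mul_le_mul_of_nonneg_right ‹c ^ 2 ≤ T ^ 2› hu
        linarith
      calc 4 * (a ^ 2 * x + c ^ 2 * y) * D ^ 2 * J3 ≤ 4 * (T ^ 2 * (x + y)) * D ^ 2 * J3 := by
            gcongr
        _ = 4 * T ^ 2 * D ^ 2 * ((x + y) * J3) := by ring
        _ ≤ 4 * T ^ 2 * D ^ 2 * e := by gcongr
        _ = _ := by ring
    -- Writing `a² x + c² y = T a x - c D` removes `y` from the noise: the part with `D` is charged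
    -- to the mean. For `a = m₂`, `c = m₁` a direct bound would leave noise `c⁴ y`, of order `m₁⁴
    -- m₂` after summation, against the required `m₁³ m₂²`.
    have t2 : 2 * (a ^ 2 * x + c ^ 2 * y) ^ 2 * J2 ≤
        2 * T ^ 2 * (D ^ 2 * e) + 4 * T ^ 2 * a ^ 2 * x := by
      have k1 : (a ^ 2 * x + c ^ 2 * y) ^ 2 ≤ 2 * (T * a * x) ^ 2 + 2 * (c * D) ^ 2 := by
        have : a ^ 2 * x + c ^ 2 * y = T * a * x - c * D := by rw [hD, hT]; ring
        rw [this]; nlinarith [sq_nonneg (T * a * x + c * D)]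
      have k2 : x * J2 ≤ 1 := le_trans (mul_le_mul_of_nonneg_right (by linarith) n2) i4
      have k3 : c ^ 2 ≤ T ^ 2 := by rw [hT]; gcongr; linarith
      calc 2 * (a ^ 2 * x + c ^ 2 * y) ^ 2 * J2
          ≤ 2 * (2 * (T * a * x) ^ 2 + 2 * (c * D) ^ 2) * J2 := by gcongr
        _ = 4 * T ^ 2 * a ^ 2 * x * (x * J2) + 4 * c ^ 2 * D ^ 2 * J2 := by ring
        _ ≤ 4 * T ^ 2 * a ^ 2 * x * 1 + 4 * T ^ 2 * D ^ 2 * (1 / 2 * e) := by gcongr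
        _ = _ := by ring
    linarith
  · rw [abs_of_nonneg (by positivity)]; exact pow_le_one₀ (by positivity) (Nat.cast_inv_le_one _)
  · push_cast; rw [div_eq_mul_inv, mul_pow]

/-! ### Markov, Chebyshev, conditioning and union bounds. -/

lemma HasIntegral.comp_measurePreserving {α β : Type*} [MeasurableSpace α] [MeasurableSpace β]
    [DiscreteMeasurableSpace β] [Countable β] {μ : Measure α} {ν : Measure β} {g : α → β}
    (hg : MeasurePreserving g μ ν) {f : β → ℝ} {v : ℝ} (hf : HasIntegral ν f v) :
    HasIntegral μ (fun x => f (g x)) v := by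
  refine ⟨?_, ?_⟩
  · have := hf.1
    rw [← hg.map_eq] at this
    exact this.comp_measurable hg.measurable
  · rw [← hf.2, ← hg.map_eq, integral_map hg.measurable.aemeasurable
      Measurable.of_discrete.aestronglyMeasurable]

lemma HasIntegral.finset_sum {Ω ι : Type*} [MeasurableSpace Ω] {ν : Measure Ω} (s : Finset ι)
    {f : ι → Ω → ℝ} {v : ι → ℝ} (h : ∀ i ∈ s, HasIntegral ν (f i) (v i)) :
    HasIntegral ν (fun x => ∑ i ∈ s, f i x) (∑ i ∈ s, v i) :=
  ⟨integrable_finsetSum _ fun i hi => (h i hi).1, by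
    rw [integral_finsetSum _ fun i hi => (h i hi).1]
    exact Finset.sum_congr rfl fun i hi => (h i hi).2⟩

/-- Markov's inequality. -/
lemma HasIntegral.measureReal_le_div {Ω : Type*} [MeasurableSpace Ω] {ν : Measure Ω}
    [IsFiniteMeasure ν] {f : Ω → ℝ} {v t : ℝ} (hf : HasIntegral ν f v) (h0 : ∀ x, 0 ≤ f x)
    (ht : 0 < t) : ν.real {x | t ≤ f x} ≤ v / t := by
  rw [le_div_iff₀ ht, mul_comm, ← hf.2]
  exact mul_meas_ge_le_integral_of_nonneg (Filter.Eventually.of_forall h0) hf.1 t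

lemma HasIntegral.indicator_one {Ω : Type*} [MeasurableSpace Ω] [DiscreteMeasurableSpace Ω]
    {ν : Measure Ω} [IsFiniteMeasure ν] (s : Set Ω) :
    HasIntegral ν (s.indicator 1) (ν.real s) :=
  ⟨(integrable_const (1 : ℝ)).indicator MeasurableSet.of_discrete,
    integral_indicator_one MeasurableSet.of_discrete⟩

/-- Chebyshev's inequality for a partial sum of independent variables. -/
lemma pi_measureReal_chebyshev {ι : Type*} [Fintype ι] {ν : ι → Measure (ℕ × ℕ)}
    [∀ i, IsProbabilityMeasure (ν i)] {f : ι → ℕ × ℕ → ℝ} {e v : ι → ℝ} (A : Finset ι)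
    (he : ∀ i ∈ A, HasIntegral (ν i) (f i) (e i))
    (hv : ∀ i ∈ A, Integrable (fun z => f i z ^ 2) (ν i) ∧ ∫ z, f i z ^ 2 ∂ν i ≤ e i ^ 2 + v i)
    {t : ℝ} (ht : 0 < t) :
    (Measure.pi ν).real {x | t ≤ |∑ i ∈ A, f i (x i) - ∑ i ∈ A, e i|} ≤
      (∑ i ∈ A, v i) / t ^ 2 := by
  classical
  -- Extending by 0 outside `A` allows the variance formula for a sum over all coordinates.
  let g : ∀ i : ι, ℕ × ℕ → ℝ := fun i z => if i ∈ A then f i z else 0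
  have hg : ∀ i, MemLp (g i) 2 (ν i) := by
    intro i
    by_cases hi : i ∈ A
    · rw [memLp_two_iff_integrable_sq Measurable.of_discrete.aestronglyMeasurable]
      simpa [g, hi] using (hv i hi).1
    · simp [g, hi]
  have hgv : ∀ i, Var[g i; ν i] ≤ if i ∈ A then v i else 0 := by
    intro i
    by_cases hi : i ∈ A
    · rw [variance_eq_sub (hg i)]
      have h1 := (he i hi).2
      have h2 := (hv i hi).2
      simp only [g, hi, if_true, Pi.pow_apply]
      rw [h1]; linarith
    · have h0 : g i = 0 := by funext z; simp [g, hi]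
      rw [h0, variance_zero, if_neg hi]
  have hvar : Var[∑ i, fun x : ι → ℕ × ℕ => g i (x i); Measure.pi ν] ≤ ∑ i ∈ A, v i := by
    rw [variance_sum_pi hg]
    refine (Finset.sum_le_sum fun i _ => hgv i).trans ?_
    simp
  have hmem : MemLp (∑ i, fun x : ι → ℕ × ℕ => g i (x i)) 2 (Measure.pi ν) :=
    memLp_finsetSum' _ fun i _ => (hg i).comp_measurePreserving (measurePreserving_eval _ i)
  have hsum : ∀ x : ι → ℕ × ℕ, (∑ i, fun x : ι → ℕ × ℕ => g i (x i)) x = ∑ i ∈ A, f i (x i) := by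
    intro x
    simp [g]
  have hE : HasIntegral (Measure.pi ν) (fun x => ∑ i ∈ A, f i (x i)) (∑ i ∈ A, e i) :=
    HasIntegral.finset_sum A fun i hi => (he i hi).comp_measurePreserving
      (measurePreserving_eval _ i)
  have hc := meas_ge_le_variance_div_sq hmem ht
  simp_rw [hsum, hE.2] at hc
  have h0 : 0 ≤ Var[∑ i, fun x : ι → ℕ × ℕ => g i (x i); Measure.pi ν] := variance_nonneg _ _
  rw [measureReal_def]
  refine (ENNReal.toReal_mono ENNReal.ofReal_ne_top hc).trans ?_
  rw [ENNReal.toReal_ofReal (by positivity)]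
  gcongr

/-- Conditioning on the first batch: once it is frozen, `B`, `M`, `H` are fixed sets, and a bound
uniform in them integrates. -/
lemma prod_measureReal_le_of_forall {α β : Type*} [MeasurableSpace α] [MeasurableSpace β]
    [DiscreteMeasurableSpace (α × β)] {μ : Measure α} {ν : Measure β} [IsProbabilityMeasure μ]
    [IsProbabilityMeasure ν] (S : Set (α × β)) {d : ℝ} (hd : 0 ≤ d)
    (h : ∀ a, ν.real {x | (a, x) ∈ S} ≤ d) : (μ.prod ν).real S ≤ d := by
  rw [measureReal_def]
  refine ENNReal.toReal_le_of_le_ofReal hd ?_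
  rw [Measure.prod_apply MeasurableSet.of_discrete]
  calc ∫⁻ a, ν (Prod.mk a ⁻¹' S) ∂μ ≤ ∫⁻ _, ENNReal.ofReal d ∂μ := by
        refine lintegral_mono fun a => ?_
        rw [← ENNReal.ofReal_toReal (measure_ne_top ν _)]
        exact ENNReal.ofReal_le_ofReal (h a)
    _ = _ := by simp

lemma measureReal_exists_le {Ω ι : Type*} [Fintype ι] [MeasurableSpace Ω] {ν : Measure Ω}
    [IsFiniteMeasure ν] (E : ι → Set Ω) {d : ι → ℝ} (h : ∀ i, ν.real (E i) ≤ d i) :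
    ν.real {x | ∃ i, x ∈ E i} ≤ ∑ i, d i := by
  have : {x | ∃ i, x ∈ E i} = ⋃ i, E i := by ext; simp
  rw [this]
  exact (measureReal_iUnion_fintype_le E).trans (Finset.sum_le_sum fun i _ => h i)

/-! ### Marginal laws of the counts. -/

section Marginals

variable {n : ℕ} (p q : PMF (Fin n)) (m₁ m₂ : ℝ)

lemma measurePreserving_fst_eval (i : Fin n) :
    MeasurePreserving (fun z : Fin n → ℕ × ℕ => (z i).1) (countMeasure p q m₁ m₂)
      (poissonMeasure (m₁.toNNReal * (p i).toNNReal)) :=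
  measurePreserving_fst.comp (measurePreserving_eval (fun i =>
    (poissonMeasure (m₁.toNNReal * (p i).toNNReal)).prod
    (poissonMeasure (m₂.toNNReal * (q i).toNNReal))) i)

lemma measurePreserving_snd_eval (i : Fin n) :
    MeasurePreserving (fun z : Fin n → ℕ × ℕ => (z i).2) (countMeasure p q m₁ m₂)
      (poissonMeasure (m₂.toNNReal * (q i).toNNReal)) :=
  measurePreserving_snd.comp (measurePreserving_eval (fun i =>
    (poissonMeasure (m₁.toNNReal * (p i).toNNReal)).prod
    (poissonMeasure (m₂.toNNReal * (q i).toNNReal))) i)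

lemma measureReal_fst_eval (i : Fin n) (s : Set ℕ) :
    (countMeasure p q m₁ m₂).real {z | (z i).1 ∈ s} =
      (poissonMeasure (m₁.toNNReal * (p i).toNNReal)).real s := by
  rw [← (measurePreserving_fst_eval p q m₁ m₂ i).measureReal_preimage
    MeasurableSet.of_discrete.nullMeasurableSet]
  rfl

lemma measureReal_snd_eval (i : Fin n) (s : Set ℕ) :
    (countMeasure p q m₁ m₂).real {z | (z i).2 ∈ s} =
      (poissonMeasure (m₂.toNNReal * (q i).toNNReal)).real s := by
  rw [← (measurePreserving_snd_eval p q m₁ m₂ i).measureReal_preimage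
    MeasurableSet.of_discrete.nullMeasurableSet]
  rfl

variable {m₁ m₂}

lemma coe_toNNReal_mul {m : ℝ} (hm : 0 ≤ m) (x : ℝ≥0∞) :
    ((m.toNNReal * x.toNNReal : ℝ≥0) : ℝ) = m * x.toReal := by
  rw [NNReal.coe_mul, Real.coe_toNNReal _ hm]; rfl

lemma sum_toReal_eq_one (p : PMF (Fin n)) : ∑ i, (p i).toReal = 1 := by
  rw [← ENNReal.toReal_sum fun i _ => PMF.apply_ne_top p i]
  have := p.tsum_coe
  rw [tsum_fintype] at this
  rw [this]; simp

lemma hasIntegral_fst_eval_div (h₁ : 0 < m₁) (i : Fin n) :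
    HasIntegral (countMeasure p q m₁ m₂) (fun z => ((z i).1 : ℝ) / m₁) (p i).toReal := by
  refine (((hasIntegral_natCast_poissonMeasure _).comp_measurePreserving
    (measurePreserving_fst_eval p q m₁ m₂ i)).const_mul (1 / m₁)).congr' (fun z => by ring) ?_
  rw [coe_toNNReal_mul h₁.le]; field_simp

lemma hasIntegral_snd_eval_div (h₂ : 0 < m₂) (i : Fin n) :
    HasIntegral (countMeasure p q m₁ m₂) (fun z => ((z i).2 : ℝ) / m₂) (q i).toReal := by
  refine (((hasIntegral_natCast_poissonMeasure _).comp_measurePreserving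
    (measurePreserving_snd_eval p q m₁ m₂ i)).const_mul (1 / m₂)).congr' (fun z => by ring) ?_
  rw [coe_toNNReal_mul h₂.le]; field_simp

lemma one_div_mul_sqrt_mul {m x : ℝ} (hm : 0 < m) : 1 / m * √(m * x) = √(x / m) := by
  have : x / m = (1 / m) ^ 2 * (m * x) := by field_simp
  rw [this, Real.sqrt_mul (x := (1 / m) ^ 2) (by positivity), Real.sqrt_sq (by positivity)]

lemma exists_hasIntegral_abs_fst_eval (h₁ : 0 < m₁) (i : Fin n) :
    ∃ v ≤ √((p i).toReal / m₁),
      HasIntegral (countMeasure p q m₁ m₂) (fun z => |((z i).1 : ℝ) / m₁ - (p i).toReal|) v := by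
  have h : HasIntegral (poissonMeasure (m₁.toNNReal * (p i).toNNReal)) (fun k : ℕ =>
    |(k : ℝ) - ((m₁.toNNReal * (p i).toNNReal : ℝ≥0) : ℝ)|) _ :=
    ⟨integrable_abs_sub_poissonMeasure _, rfl⟩
  have h2 := integral_abs_sub_poissonMeasure_le (m₁.toNNReal * (p i).toNNReal)
  rw [coe_toNNReal_mul h₁.le] at h h2
  refine ⟨_, ?_, ((h.comp_measurePreserving (measurePreserving_fst_eval p q m₁ m₂ i)).const_mul
    (1 / m₁)).congr' (fun z => ?_) rfl⟩
  · rw [← one_div_mul_sqrt_mul h₁]; gcongr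
  · nth_rw 1 [← abs_of_pos (show 0 < 1 / m₁ by positivity)]
    rw [← abs_mul]
    congr 1; field_simp

lemma exists_hasIntegral_abs_snd_eval (h₂ : 0 < m₂) (i : Fin n) :
    ∃ v ≤ √((q i).toReal / m₂),
      HasIntegral (countMeasure p q m₁ m₂) (fun z => |((z i).2 : ℝ) / m₂ - (q i).toReal|) v := by
  have h : HasIntegral (poissonMeasure (m₂.toNNReal * (q i).toNNReal)) (fun k : ℕ =>
    |(k : ℝ) - ((m₂.toNNReal * (q i).toNNReal : ℝ≥0) : ℝ)|) _ :=
    ⟨integrable_abs_sub_poissonMeasure _, rfl⟩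
  have h2 := integral_abs_sub_poissonMeasure_le (m₂.toNNReal * (q i).toNNReal)
  rw [coe_toNNReal_mul h₂.le] at h h2
  refine ⟨_, ?_, ((h.comp_measurePreserving (measurePreserving_snd_eval p q m₁ m₂ i)).const_mul
    (1 / m₂)).congr' (fun z => ?_) rfl⟩
  · rw [← one_div_mul_sqrt_mul h₂]; gcongr
  · nth_rw 1 [← abs_of_pos (show 0 < 1 / m₂ by positivity)]
    rw [← abs_mul]
    congr 1; field_simp

end Marginals

/-! ### Bad events for the sets and the statistics. -/

/-- The heavy set as a function of the counts of the first batches. -/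
noncomputable def heavyCounts {n : ℕ} (ε m₁ m₂ : ℝ) (z : Fin n → ℕ × ℕ) : Finset (Fin n) :=
  Finset.univ.filter (fun i => ((z i).1 : ℝ) / m₁ > b n ε m₂) ∪
    Finset.univ.filter (fun i => ((z i).2 : ℝ) / m₂ > b n ε m₂)

/-- The medium set as a function of the counts of the first batches. -/
noncomputable def mediumCounts {n : ℕ} (ε m₁ m₂ : ℝ) (z : Fin n → ℕ × ℕ) : Finset (Fin n) :=
  {i | b' n m₂ ≤ max (((z i).1 : ℝ) / m₁) (((z i).2 : ℝ) / m₂) ∧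
    max (((z i).1 : ℝ) / m₁) (((z i).2 : ℝ) / m₂) ≤ b n ε m₂}

/-- The light set as a function of the counts of the first batches. -/
noncomputable def lightCounts {n : ℕ} (ε m₁ m₂ : ℝ) (z : Fin n → ℕ × ℕ) : Finset (Fin n) :=
  (heavyCounts ε m₁ m₂ z ∪ mediumCounts ε m₁ m₂ z)ᶜ

lemma heavy_eq_heavyCounts {n : ℕ} (ε m₁ m₂ : ℝ) (s : Samples n) :
    heavy ε m₁ m₂ s = heavyCounts ε m₁ m₂ s.counts.1 := rfl

lemma medium_eq_mediumCounts {n : ℕ} (ε m₁ m₂ : ℝ) (s : Samples n) :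
    medium ε m₁ m₂ s = mediumCounts ε m₁ m₂ s.counts.1 := rfl

lemma light_eq_lightCounts {n : ℕ} (ε m₁ m₂ : ℝ) (s : Samples n) :
    light ε m₁ m₂ s = lightCounts ε m₁ m₂ s.counts.1 := rfl

lemma statW_eq {n : ℕ} (m₁ m₂ : ℝ) (s : Samples n) (A : Finset (Fin n)) :
    statW m₁ m₂ s A = ∑ i ∈ A, centeredSq m₂ m₁ (s.counts.2 i) := rfl

lemma statZ_eq {n : ℕ} (m₁ m₂ : ℝ) (s : Samples n) (A : Finset (Fin n)) :
    statZ m₁ m₂ s A = ∑ i ∈ A, centeredSq m₂ m₁ (s.counts.2 i) /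
      (((s.counts.2 i).1 : ℝ) + (s.counts.2 i).2) := rfl

lemma HasIntegral.mul_prod {α β : Type*} [MeasurableSpace α] [MeasurableSpace β] {μ : Measure α}
    {ν : Measure β} [SFinite μ] [SFinite ν] {f : α → ℝ} {g : β → ℝ} {v w : ℝ}
    (hf : HasIntegral μ f v) (hg : HasIntegral ν g w) :
    HasIntegral (μ.prod ν) (fun x => f x.1 * g x.2) (v * w) :=
  ⟨hf.1.mul_prod hg.1, by rw [integral_prod_mul, hf.2, hg.2]⟩

section Events

variable {n : ℕ} (p q : PMF (Fin n)) {m₁ m₂ : ℝ}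

/-- Deviations from the mean frequencies, summed over the heavy set. -/
lemma measureReal_heavy_deviation_le {ε : ℝ} (h₂ : 0 < m₂) (h₁₂ : m₂ ≤ m₁)
    (hb : 0 < b n ε m₂) {t : ℝ} (ht : 0 < t) :
    ((countMeasure p q m₁ m₂).prod (countMeasure p q m₁ m₂)).real
      {x | t ≤ ∑ i ∈ heavyCounts ε m₁ m₂ x.1, (|((x.2 i).1 : ℝ) / m₁ - (p i).toReal| +
        |((x.2 i).2 : ℝ) / m₂ - (q i).toReal|)} ≤ 4 / √(b n ε m₂ * m₂) / t := by
  have h₁ : 0 < m₁ := h₂.trans_le h₁₂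
  set Q := countMeasure p q m₁ m₂
  choose u hu hu' using exists_hasIntegral_abs_fst_eval p q (m₂ := m₂) h₁
  choose v hv hv' using exists_hasIntegral_abs_snd_eval p q (m₁ := m₁) h₂
  set H : Fin n → Set (Fin n → ℕ × ℕ) := fun i => {z | i ∈ heavyCounts ε m₁ m₂ z}
  have key : ∀ i, HasIntegral (Q.prod Q) _ _ := fun i =>
    (HasIntegral.indicator_one (ν := Q) (H i)).mul_prod ((hu' i).add (hv' i))
  have hsum := HasIntegral.finset_sum Finset.univ fun i _ => key i
  have hfun : ∀ x : (Fin n → ℕ × ℕ) × (Fin n → ℕ × ℕ),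
      ∑ i ∈ heavyCounts ε m₁ m₂ x.1, (|((x.2 i).1 : ℝ) / m₁ - (p i).toReal| +
        |((x.2 i).2 : ℝ) / m₂ - (q i).toReal|) =
      ∑ i, (H i).indicator 1 x.1 * (|((x.2 i).1 : ℝ) / m₁ - (p i).toReal| +
        |((x.2 i).2 : ℝ) / m₂ - (q i).toReal|) := by
    intro x
    rw [← Finset.sum_filter_add_sum_filter_not Finset.univ (· ∈ heavyCounts ε m₁ m₂ x.1)]
    rw [Finset.sum_eq_zero (s := Finset.univ.filter (· ∉ heavyCounts ε m₁ m₂ x.1)), add_zero]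
    · rw [Finset.filter_univ_mem]
      refine Finset.sum_congr rfl fun i hi => ?_
      rw [Set.indicator_of_mem (show x.1 ∈ H i from hi)]; simp
    · intro i hi
      rw [Set.indicator_of_notMem (show x.1 ∉ H i from (Finset.mem_filter.1 hi).2)]; simp
  have hM := (hsum.congr' hfun rfl).measureReal_le_div (t := t)
    (fun x => Finset.sum_nonneg fun i _ => by positivity) ht
  refine hM.trans ?_
  have hheavy : ∀ i, Q.real (H i) ≤ ((p i).toReal + (q i).toReal) / b n ε m₂ := by
    intro i
    refine le_trans ?_ (HasIntegral.measureReal_le_div ((hasIntegral_fst_eval_div p q h₁ i).add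
      (hasIntegral_snd_eval_div p q h₂ i)) (fun z => by positivity) hb)
    refine measureReal_mono fun z hz => ?_
    simp only [H, heavyCounts, Set.mem_ofPred_eq, Finset.mem_union, Finset.mem_filter,
      Finset.mem_univ, true_and] at hz ⊢
    have a1 : 0 ≤ ((z i).1 : ℝ) / m₁ := by positivity
    have a2 : 0 ≤ ((z i).2 : ℝ) / m₂ := by positivity
    rcases hz with hz | hz <;> linarith
  have hterm : ∀ i, Q.real (H i) * (u i + v i) ≤
      2 / √(b n ε m₂ * m₂) * ((p i).toReal + (q i).toReal) := by
    intro i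
    have hp0 : 0 ≤ (p i).toReal := ENNReal.toReal_nonneg
    have hq0 : 0 ≤ (q i).toReal := ENNReal.toReal_nonneg
    set s := (p i).toReal + (q i).toReal with hs
    have hs0 : 0 ≤ s := by positivity
    have e1 : u i + v i ≤ 2 * √(s / m₂) := by
      have : u i ≤ √(s / m₂) := (hu i).trans (by gcongr; linarith)
      have : v i ≤ √(s / m₂) := (hv i).trans (by gcongr; linarith)
      linarith
    -- Membership has probability at most `min 1 (s/b) ≤ √(s/b)`. Multiplied by a deviation of order
    -- `√(s/m₂)` this is linear in `s`, and the `s` sum to 2.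
    have e2 : Q.real (H i) ≤ √(s / b n ε m₂) := by
      rcases le_total (s / b n ε m₂) 1 with h | h
      · refine (hheavy i).trans (Real.le_sqrt_of_sq_le ?_)
        have : 0 ≤ s / b n ε m₂ := by positivity
        nlinarith
      · exact measureReal_le_one.trans (by rw [Real.one_le_sqrt]; exact h)
    calc Q.real (H i) * (u i + v i) ≤ Q.real (H i) * (2 * √(s / m₂)) :=
          mul_le_mul_of_nonneg_left e1 measureReal_nonneg
      _ ≤ √(s / b n ε m₂) * (2 * √(s / m₂)) := by gcongr
      _ = 2 * √((s / b n ε m₂) * (s / m₂)) := by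
          rw [Real.sqrt_mul (by positivity)]; ring
      _ = _ := by
          rw [div_mul_div_comm, Real.sqrt_div (by positivity), Real.sqrt_mul_self hs0]; ring
  gcongr
  refine (Finset.sum_le_sum fun i _ => hterm i).trans (le_of_eq ?_)
  rw [← Finset.mul_sum, Finset.sum_add_distrib, sum_toReal_eq_one, sum_toReal_eq_one]
  ring

/-- Each medium element adds at least `b'` to the sum of all frequencies of both samples, which has
mean 2; Markov at level 25. -/
lemma measureReal_card_medium_le {ε : ℝ} (h₁ : 0 < m₁) (h₂ : 0 < m₂) (hb : 0 < b' n m₂) :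
    (countMeasure p q m₁ m₂).real {z | 25 / b' n m₂ ≤ ((mediumCounts ε m₁ m₂ z).card : ℝ)} ≤
      2 / 25 := by
  have h := HasIntegral.finset_sum Finset.univ fun i _ =>
    (hasIntegral_fst_eval_div p q (m₂ := m₂) h₁ i).add (hasIntegral_snd_eval_div p q h₂ i)
  rw [Finset.sum_add_distrib, sum_toReal_eq_one, sum_toReal_eq_one] at h
  have hM := h.measureReal_le_div (t := 25) (fun z => Finset.sum_nonneg fun i _ => by positivity)
    (by norm_num)
  refine (measureReal_mono fun z hz => ?_).trans (hM.trans (by norm_num))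
  simp only [Set.mem_ofPred_eq] at hz ⊢
  rw [div_le_iff₀ hb] at hz
  refine hz.trans ?_
  calc ((mediumCounts ε m₁ m₂ z).card : ℝ) * b' n m₂
        = ∑ i ∈ mediumCounts ε m₁ m₂ z, b' n m₂ := by simp
    _ ≤ ∑ i ∈ mediumCounts ε m₁ m₂ z, (((z i).1 : ℝ) / m₁ + ((z i).2 : ℝ) / m₂) := by
        refine Finset.sum_le_sum fun i hi => ?_
        simp only [mediumCounts, Finset.mem_filter, Finset.mem_univ, true_and] at hi
        exact hi.1.trans (max_le_add_of_nonneg (by positivity) (by positivity))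
    _ ≤ _ := Finset.sum_le_univ_sum_of_nonneg fun i => by positivity

/-- For an element of probability above `2b` to be medium, a count must fall below half its mean.
The bound provides the upper estimate on `p_i`, `q_i` needed for the variance of `W`. -/
lemma measureReal_medium_large_le {ε : ℝ} (h₂ : 0 < m₂) (h₁₂ : m₂ ≤ m₁) :
    (countMeasure p q m₁ m₂).real {z | ∃ i, i ∈ mediumCounts ε m₁ m₂ z ∧
      (2 * b n ε m₂ < (p i).toReal ∨ 2 * b n ε m₂ < (q i).toReal)} ≤
      2 * n * Real.exp (-(b n ε m₂ * m₂) / 4) := by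
  have h₁ : 0 < m₁ := h₂.trans_le h₁₂
  have hone : ∀ i, (countMeasure p q m₁ m₂).real {z | i ∈ mediumCounts ε m₁ m₂ z ∧
      (2 * b n ε m₂ < (p i).toReal ∨ 2 * b n ε m₂ < (q i).toReal)} ≤
      2 * Real.exp (-(b n ε m₂ * m₂) / 4) := by
    intro i
    rcases le_or_gt (b n ε m₂) 0 with hb | hb
    · have : 1 ≤ Real.exp (-(b n ε m₂ * m₂) / 4) := Real.one_le_exp (by nlinarith)
      exact measureReal_le_one.trans (by linarith)
    have hp : (countMeasure p q m₁ m₂).real {z | i ∈ mediumCounts ε m₁ m₂ z ∧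
        2 * b n ε m₂ < (p i).toReal} ≤ Real.exp (-(b n ε m₂ * m₂) / 4) := by
      by_cases hp : 2 * b n ε m₂ < (p i).toReal
      · refine (measureReal_mono (s₂ := {z | (z i).1 ∈ {k : ℕ | (k : ℝ) ≤ b n ε m₂ * m₁}})
          fun z hz => ?_).trans ?_
        · simp only [mediumCounts, Set.mem_ofPred_eq, Finset.mem_filter, Finset.mem_univ,
            true_and] at hz ⊢
          exact (div_le_iff₀ h₁).1 ((le_max_left _ _).trans hz.1.2)
        · rw [measureReal_fst_eval]
          refine (poissonMeasure_real_le_half _ ?_).trans ?_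
          · rw [coe_toNNReal_mul h₁.le]; nlinarith
          · rw [coe_toNNReal_mul h₁.le]
            apply Real.exp_le_exp.2
            have := mul_le_mul h₁₂ hp.le (by positivity) h₁.le
            linarith
      · simp [hp]; positivity
    have hq : (countMeasure p q m₁ m₂).real {z | i ∈ mediumCounts ε m₁ m₂ z ∧
        2 * b n ε m₂ < (q i).toReal} ≤ Real.exp (-(b n ε m₂ * m₂) / 4) := by
      by_cases hq : 2 * b n ε m₂ < (q i).toReal
      · refine (measureReal_mono (s₂ := {z | (z i).2 ∈ {k : ℕ | (k : ℝ) ≤ b n ε m₂ * m₂}})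
          fun z hz => ?_).trans ?_
        · simp only [mediumCounts, Set.mem_ofPred_eq, Finset.mem_filter, Finset.mem_univ,
            true_and] at hz ⊢
          exact (div_le_iff₀ h₂).1 ((le_max_right _ _).trans hz.1.2)
        · rw [measureReal_snd_eval]
          refine (poissonMeasure_real_le_half _ ?_).trans ?_
          · rw [coe_toNNReal_mul h₂.le]; nlinarith
          · rw [coe_toNNReal_mul h₂.le]
            apply Real.exp_le_exp.2
            have := mul_le_mul_of_nonneg_left hq.le h₂.le
            linarith
      · simp [hq]; positivity
    refine (measureReal_mono (s₂ := {z | i ∈ mediumCounts ε m₁ m₂ z ∧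
      2 * b n ε m₂ < (p i).toReal} ∪ {z | i ∈ mediumCounts ε m₁ m₂ z ∧
      2 * b n ε m₂ < (q i).toReal}) (fun z hz => ?_)).trans ((measureReal_union_le _ _).trans
      (by linarith))
    simp only [Set.mem_ofPred_eq, Set.mem_union] at hz ⊢
    tauto
  refine (measureReal_exists_le _ hone).trans (le_of_eq ?_)
  simp; ring

lemma centeredSq_moments {m₁ m₂ : ℝ} (h₁ : 0 < m₁) (h₂ : 0 < m₂) (x y : ℝ≥0∞) :
    HasIntegral ((poissonMeasure (m₁.toNNReal * x.toNNReal)).prod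
        (poissonMeasure (m₂.toNNReal * y.toNNReal))) (centeredSq m₂ m₁)
      (m₁ ^ 2 * m₂ ^ 2 * (x.toReal - y.toReal) ^ 2) ∧
    Integrable (fun z => centeredSq m₂ m₁ z ^ 2) ((poissonMeasure (m₁.toNNReal * x.toNNReal)).prod
        (poissonMeasure (m₂.toNNReal * y.toNNReal))) ∧
    ∫ z, centeredSq m₂ m₁ z ^ 2 ∂((poissonMeasure (m₁.toNNReal * x.toNNReal)).prod
        (poissonMeasure (m₂.toNNReal * y.toNNReal))) =
      (m₁ ^ 2 * m₂ ^ 2 * (x.toReal - y.toReal) ^ 2) ^ 2 +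
      (4 * (m₁ * m₂ * (m₂ * x.toReal + m₁ * y.toReal)) *
          (m₁ ^ 2 * m₂ ^ 2 * (x.toReal - y.toReal) ^ 2) +
        2 * (m₁ * m₂ * (m₂ * x.toReal + m₁ * y.toReal)) ^ 2) := by
  have hE := hasIntegral_centeredSq (m₁.toNNReal * x.toNNReal) (m₂.toNNReal * y.toNNReal) m₂ m₁
    (w := fun _ => 1) (C := 1) (by simp)
  have hE2 := hasIntegral_centeredSq_sq (m₁.toNNReal * x.toNNReal) (m₂.toNNReal * y.toNNReal)
    m₂ m₁ (w := fun _ => 1) (C := 1) (by simp)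
  rw [coe_toNNReal_mul h₁.le, coe_toNNReal_mul h₂.le] at hE hE2
  simp only [mul_one, integral_const, probReal_univ, smul_eq_mul] at hE hE2
  refine ⟨hE.congr' (fun _ => rfl) (by ring), hE2.1, hE2.2.trans (by ring)⟩

/-- Concentration of the statistic `W` over a fixed set. -/
lemma measureReal_statW_deviation_le (h₁ : 0 < m₁) (h₂ : 0 < m₂) (h₁₂ : m₂ ≤ m₁)
    (A : Finset (Fin n)) {β : ℝ} (hp : ∀ i ∈ A, (p i).toReal ≤ 2 * β)
    (hq : ∀ i ∈ A, (q i).toReal ≤ 2 * β) (hβ : 0 ≤ β) {t : ℝ} (ht : 0 < t) :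
    (countMeasure p q m₁ m₂).real {w | t ≤ |∑ i ∈ A, centeredSq m₂ m₁ (w i) -
      ∑ i ∈ A, m₁ ^ 2 * m₂ ^ 2 * ((p i).toReal - (q i).toReal) ^ 2|} ≤
      (16 * β * m₁ ^ 2 * m₂ *
          (∑ i ∈ A, m₁ ^ 2 * m₂ ^ 2 * ((p i).toReal - (q i).toReal) ^ 2) +
        16 * β * m₁ ^ 4 * m₂ ^ 2) / t ^ 2 := by
  have hc := pi_measureReal_chebyshev A
    (fun i _ => (centeredSq_moments h₁ h₂ (p i) (q i)).1)
    (fun i _ => ⟨(centeredSq_moments h₁ h₂ (p i) (q i)).2.1,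
      (centeredSq_moments h₁ h₂ (p i) (q i)).2.2.le⟩) ht
  refine hc.trans ?_
  gcongr
  rw [Finset.sum_add_distrib, Finset.mul_sum]
  have hpn : ∀ i, 0 ≤ (p i).toReal := fun i => ENNReal.toReal_nonneg
  have hqn : ∀ i, 0 ≤ (q i).toReal := fun i => ENNReal.toReal_nonneg
  have hσ : ∀ i, m₁ * m₂ * (m₂ * (p i).toReal + m₁ * (q i).toReal) ≤
      m₁ ^ 2 * m₂ * ((p i).toReal + (q i).toReal) := by
    intro i
    have := mul_le_mul_of_nonneg_right h₁₂ (hpn i)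
    calc m₁ * m₂ * (m₂ * (p i).toReal + m₁ * (q i).toReal)
        ≤ m₁ * m₂ * (m₁ * (p i).toReal + m₁ * (q i).toReal) := by gcongr
      _ = _ := by ring
  -- In the quadratic noise one factor `p_i + q_i` is bounded by `4β`; the other is kept and summed
  -- to at most 2.
  refine add_le_add (Finset.sum_le_sum fun i hi => ?_) ?_
  · refine mul_le_mul_of_nonneg_right ?_ (by positivity)
    calc 4 * (m₁ * m₂ * (m₂ * (p i).toReal + m₁ * (q i).toReal))
        ≤ 4 * (m₁ ^ 2 * m₂ * ((p i).toReal + (q i).toReal)) :=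
          mul_le_mul_of_nonneg_left (hσ i) (by norm_num)
      _ ≤ 4 * (m₁ ^ 2 * m₂ * (2 * β + 2 * β)) := by gcongr; exact hp i hi; exact hq i hi
      _ = _ := by ring
  · calc ∑ i ∈ A, 2 * (m₁ * m₂ * (m₂ * (p i).toReal + m₁ * (q i).toReal)) ^ 2
        ≤ ∑ i ∈ A, 8 * β * m₁ ^ 4 * m₂ ^ 2 * ((p i).toReal + (q i).toReal) := by
          refine Finset.sum_le_sum fun i hi => ?_
          have n0 : 0 ≤ m₁ * m₂ * (m₂ * (p i).toReal + m₁ * (q i).toReal) :=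
            mul_nonneg (by positivity)
              (add_nonneg (mul_nonneg h₂.le (hpn i)) (mul_nonneg h₁.le (hqn i)))
          have s0 : 0 ≤ (p i).toReal + (q i).toReal := add_nonneg (hpn i) (hqn i)
          have s1 : (p i).toReal + (q i).toReal ≤ 4 * β := by linarith [hp i hi, hq i hi]
          calc 2 * (m₁ * m₂ * (m₂ * (p i).toReal + m₁ * (q i).toReal)) ^ 2
              ≤ 2 * (m₁ ^ 2 * m₂ * ((p i).toReal + (q i).toReal)) ^ 2 := by
                gcongr 2 * ?_ ^ 2; exact hσ i
            _ = 2 * m₁ ^ 4 * m₂ ^ 2 * (((p i).toReal + (q i).toReal) *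
                ((p i).toReal + (q i).toReal)) := by ring
            _ ≤ 2 * m₁ ^ 4 * m₂ ^ 2 * ((4 * β) * ((p i).toReal + (q i).toReal)) := by gcongr
            _ = _ := by ring
      _ ≤ ∑ i, 8 * β * m₁ ^ 4 * m₂ ^ 2 * ((p i).toReal + (q i).toReal) :=
          Finset.sum_le_univ_sum_of_nonneg fun i =>
            mul_nonneg (by positivity) (add_nonneg (hpn i) (hqn i))
      _ = _ := by
          rw [← Finset.mul_sum, Finset.sum_add_distrib, sum_toReal_eq_one, sum_toReal_eq_one]
          ring

/-- Mean and concentration of the statistic `Z` over a fixed set. -/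
lemma exists_measureReal_statZ_deviation_le (h₁ : 0 < m₁) (h₂ : 0 < m₂) (A : Finset (Fin n)) :
    ∃ e : Fin n → ℝ,
      (∀ i, m₁ ^ 2 * m₂ ^ 2 * ((p i).toReal - (q i).toReal) ^ 2 /
        (m₁ * (p i).toReal + m₂ * (q i).toReal + 2) ≤ e i) ∧
      (∀ i, (p i).toReal = (q i).toReal → e i = 0) ∧
      ∀ t : ℝ, 0 < t → (countMeasure p q m₁ m₂).real
        {w | t ≤ |∑ i ∈ A, centeredSq m₂ m₁ (w i) / (((w i).1 : ℝ) + (w i).2) - ∑ i ∈ A, e i|} ≤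
        (10 * (m₁ + m₂) ^ 2 * (∑ i ∈ A, e i) + 4 * (m₁ + m₂) ^ 2 * m₂ ^ 2 * m₁) / t ^ 2 := by
  have hE := fun i => hasIntegral_centeredSq_div (m₁.toNNReal * (p i).toNNReal)
    (m₂.toNNReal * (q i).toNNReal) m₂ m₁
  have hV := fun i => integral_centeredSq_div_sq_le (m₁.toNNReal * (p i).toNNReal)
    (m₂.toNNReal * (q i).toNNReal) h₂.le h₁.le
  have hJ := fun i => one_div_le_integral_inv_add_two (m₁.toNNReal * (p i).toNNReal +
    m₂.toNNReal * (q i).toNNReal)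
  simp only [NNReal.coe_add, coe_toNNReal_mul h₁.le, coe_toNNReal_mul h₂.le] at hE hV hJ
  refine ⟨fun i => (m₂ * (m₁ * (p i).toReal) - m₁ * (m₂ * (q i).toReal)) ^ 2 *
    ∫ s : ℕ, ((s + 2 : ℕ) : ℝ)⁻¹ ∂poissonMeasure (m₁.toNNReal * (p i).toNNReal +
    m₂.toNNReal * (q i).toNNReal), fun i => ?_, fun i hi => ?_, fun t ht => ?_⟩
  · calc m₁ ^ 2 * m₂ ^ 2 * ((p i).toReal - (q i).toReal) ^ 2 /
        (m₁ * (p i).toReal + m₂ * (q i).toReal + 2)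
        = (m₂ * (m₁ * (p i).toReal) - m₁ * (m₂ * (q i).toReal)) ^ 2 *
          (1 / (m₁ * (p i).toReal + m₂ * (q i).toReal + 2)) := by ring
      _ ≤ _ := mul_le_mul_of_nonneg_left (hJ i) (sq_nonneg _)
  · simp only [hi]; ring
  · have hc := pi_measureReal_chebyshev A (fun i _ => hE i)
      (v := fun i => 10 * (m₁ + m₂) ^ 2 * ((m₂ * (m₁ * (p i).toReal) -
        m₁ * (m₂ * (q i).toReal)) ^ 2 *
        ∫ s : ℕ, ((s + 2 : ℕ) : ℝ)⁻¹ ∂poissonMeasure (m₁.toNNReal * (p i).toNNReal +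
        m₂.toNNReal * (q i).toNNReal)) + 4 * (m₁ + m₂) ^ 2 * m₂ ^ 2 * (m₁ * (p i).toReal))
      (fun i _ => ⟨(hV i).1, (hV i).2.trans (le_of_eq (by ring))⟩) ht
    refine hc.trans ?_
    gcongr
    rw [Finset.sum_add_distrib, ← Finset.mul_sum]
    gcongr
    calc ∑ i ∈ A, 4 * (m₁ + m₂) ^ 2 * m₂ ^ 2 * (m₁ * (p i).toReal)
        ≤ ∑ i, 4 * (m₁ + m₂) ^ 2 * m₂ ^ 2 * (m₁ * (p i).toReal) :=
          Finset.sum_le_univ_sum_of_nonneg fun i => by positivity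
      _ = _ := by
        simp_rw [← mul_assoc]
        rw [← Finset.mul_sum, sum_toReal_eq_one, mul_one]

/-- Concentration of the number of samples. -/
lemma measureReal_sum_fst_le (h₁ : 0 < m₁) {t : ℝ} (ht : 0 < t) :
    (countMeasure p q m₁ m₂).real {w | t ≤ |∑ i, ((w i).1 : ℝ) - m₁|} ≤ m₁ / t ^ 2 := by
  have hE := fun i => (hasIntegral_natCast_poissonMeasure
    (m₁.toNNReal * (p i).toNNReal)).comp_measurePreserving (measurePreserving_fst
      (μ := poissonMeasure (m₁.toNNReal * (p i).toNNReal))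
      (ν := poissonMeasure (m₂.toNNReal * (q i).toNNReal)))
  have hV := fun i => ((hasIntegral_sub_sq_poissonMeasure
    (m₁.toNNReal * (p i).toNNReal)).comp_measurePreserving (measurePreserving_fst
      (μ := poissonMeasure (m₁.toNNReal * (p i).toNNReal))
      (ν := poissonMeasure (m₂.toNNReal * (q i).toNNReal))))
  simp only [coe_toNNReal_mul h₁.le] at hE hV
  have hV2 := fun i => (((hV i).add ((hE i).const_mul (2 * (m₁ * (p i).toReal)))).sub
    (HasIntegral.const ((m₁ * (p i).toReal) ^ 2))).congr' (g := fun z : ℕ × ℕ => (z.1 : ℝ) ^ 2)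
    (w := (m₁ * (p i).toReal) ^ 2 + m₁ * (p i).toReal) (fun z => by ring) (by ring)
  have hc := pi_measureReal_chebyshev Finset.univ (fun i _ => hE i)
    (fun i _ => ⟨(hV2 i).1, (hV2 i).2.le⟩) ht
  rwa [← Finset.mul_sum, sum_toReal_eq_one, mul_one] at hc

lemma measureReal_sum_snd_le (h₂ : 0 < m₂) {t : ℝ} (ht : 0 < t) :
    (countMeasure p q m₁ m₂).real {w | t ≤ |∑ i, ((w i).2 : ℝ) - m₂|} ≤ m₂ / t ^ 2 := by
  have hE := fun i => (hasIntegral_natCast_poissonMeasure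
    (m₂.toNNReal * (q i).toNNReal)).comp_measurePreserving (measurePreserving_snd
      (μ := poissonMeasure (m₁.toNNReal * (p i).toNNReal))
      (ν := poissonMeasure (m₂.toNNReal * (q i).toNNReal)))
  have hV := fun i => ((hasIntegral_sub_sq_poissonMeasure
    (m₂.toNNReal * (q i).toNNReal)).comp_measurePreserving (measurePreserving_snd
      (μ := poissonMeasure (m₁.toNNReal * (p i).toNNReal))
      (ν := poissonMeasure (m₂.toNNReal * (q i).toNNReal))))
  simp only [coe_toNNReal_mul h₂.le] at hE hV
  have hV2 := fun i => (((hV i).add ((hE i).const_mul (2 * (m₂ * (q i).toReal)))).sub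
    (HasIntegral.const ((m₂ * (q i).toReal) ^ 2))).congr' (g := fun z : ℕ × ℕ => (z.2 : ℝ) ^ 2)
    (w := (m₂ * (q i).toReal) ^ 2 + m₂ * (q i).toReal) (fun z => by ring) (by ring)
  have hc := pi_measureReal_chebyshev Finset.univ (fun i _ => hE i)
    (fun i _ => ⟨(hV2 i).1, (hV2 i).2.le⟩) ht
  rwa [← Finset.mul_sum, sum_toReal_eq_one, mul_one] at hc

/-- The statistic `R` is small if the two distributions agree. -/
lemma measureReal_statR_le (h₁ : 0 < m₁) (h₂ : 0 < m₂) :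
    (countMeasure p p m₁ m₂).real {w | 10 * (m₂ ^ 2 / m₁) ≤
      ∑ i, (if (w i).2 = 2 then (1 : ℝ) else 0) / (((w i).1 : ℝ) + 1)} ≤ 1 / 20 := by
  have hi : ∀ i, ∃ v ≤ m₂ ^ 2 / m₁ / 2 * (p i).toReal, HasIntegral (countMeasure p p m₁ m₂)
      (fun w => (if (w i).2 = 2 then (1 : ℝ) else 0) / (((w i).1 : ℝ) + 1)) v := by
    intro i
    have a1 : HasIntegral (poissonMeasure (m₁.toNNReal * (p i).toNNReal))
      (fun k : ℕ => 1 / ((k : ℝ) + 1)) _ := ⟨integrable_of_bounded _ (C := 1) fun k => by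
        rw [abs_of_nonneg (by positivity), div_le_one (by positivity)]; simp, rfl⟩
    have a2 : HasIntegral (poissonMeasure (m₂.toNNReal * (p i).toNNReal))
      (fun k : ℕ => if k = 2 then (1 : ℝ) else 0) _ := ⟨integrable_of_bounded _ (C := 1) fun k => by
        split_ifs <;> simp, rfl⟩
    have b1 := mul_integral_inv_succ_poissonMeasure_le (m₁.toNNReal * (p i).toNNReal)
    have b2 := integral_indicator_two_poissonMeasure_le (m₂.toNNReal * (p i).toNNReal)
    rw [coe_toNNReal_mul h₁.le] at b1
    rw [coe_toNNReal_mul h₂.le] at b2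
    have b0 : 0 ≤ ∫ k : ℕ, 1 / ((k : ℝ) + 1) ∂poissonMeasure (m₁.toNNReal * (p i).toNNReal) :=
      integral_nonneg fun k => by positivity
    refine ⟨_, ?_, ((a1.mul_prod a2).comp_measurePreserving (measurePreserving_eval (fun i =>
      (poissonMeasure (m₁.toNNReal * (p i).toNNReal)).prod
      (poissonMeasure (m₂.toNNReal * (p i).toNNReal))) i)).congr' (fun w => ?_) rfl⟩
    · set I := ∫ k : ℕ, 1 / ((k : ℝ) + 1) ∂poissonMeasure (m₁.toNNReal * (p i).toNNReal)
      refine (mul_le_mul_of_nonneg_left b2 b0).trans ?_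
      have hx : 0 ≤ (p i).toReal := ENNReal.toReal_nonneg
      calc I * ((m₂ * (p i).toReal) ^ 2 / 2)
          = m₂ ^ 2 / m₁ / 2 * (p i).toReal * (m₁ * (p i).toReal * I) := by field_simp
        _ ≤ m₂ ^ 2 / m₁ / 2 * (p i).toReal * 1 := by gcongr
        _ = _ := by ring
    · ring
  choose v hv hv' using hi
  have hM := (HasIntegral.finset_sum Finset.univ fun i _ => hv' i).measureReal_le_div
    (t := 10 * (m₂ ^ 2 / m₁)) (fun w => Finset.sum_nonneg fun i _ => by positivity)
    (by positivity)
  refine hM.trans ?_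
  rw [div_le_iff₀ (by positivity)]
  refine (Finset.sum_le_sum fun i _ => hv i).trans (le_of_eq ?_)
  rw [← Finset.mul_sum, sum_toReal_eq_one]; ring

/-- If the two distributions agree, elements seen often in the second sample only are rare. -/
lemma measureReal_exists_three_le (h₁ : 0 < m₁) (h₂ : 0 < m₂) (t : ℝ) :
    (countMeasure p p m₁ m₂).real {w | ∃ i, 3 ≤ (w i).2 ∧ ((w i).1 : ℝ) ≤ t} ≤
      m₂ * (2 * m₂ * t / m₁) ^ 2 + n * Real.exp (-t / 4) := by
  have hi : ∀ i, (countMeasure p p m₁ m₂).real {w | 3 ≤ (w i).2 ∧ ((w i).1 : ℝ) ≤ t} ≤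
      m₂ * (2 * m₂ * t / m₁) ^ 2 * (p i).toReal + Real.exp (-t / 4) := by
    intro i
    have hx : 0 ≤ (p i).toReal := ENNReal.toReal_nonneg
    -- Small `p_i`: the third factorial moment gives `(m₂ p_i)³`, of which one factor `p_i` is kept
    -- for summation. Large `p_i`: the first count would be below half its mean.
    rcases le_total (m₁ * (p i).toReal) (2 * t) with h | h
    · refine (measureReal_mono (s₂ := {w | (w i).2 ∈ {k : ℕ | 3 ≤ k}})
        fun w hw => hw.1).trans ?_
      rw [measureReal_snd_eval]
      refine (poissonMeasure_real_three_le _).trans ?_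
      rw [coe_toNNReal_mul h₂.le]
      have : (p i).toReal ≤ 2 * t / m₁ := by rw [le_div_iff₀ h₁]; linarith
      have hexp := (Real.exp_pos (-t / 4)).le
      calc (m₂ * (p i).toReal) ^ 3 = m₂ * (m₂ * (p i).toReal) ^ 2 * (p i).toReal := by ring
        _ ≤ m₂ * (m₂ * (2 * t / m₁)) ^ 2 * (p i).toReal := by gcongr
        _ = m₂ * (2 * m₂ * t / m₁) ^ 2 * (p i).toReal := by ring
        _ ≤ _ := by linarith
    · refine (measureReal_mono (s₂ := {w | (w i).1 ∈ {k : ℕ | (k : ℝ) ≤ t}})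
        fun w hw => hw.2).trans ?_
      rw [measureReal_fst_eval]
      refine (poissonMeasure_real_le_half _ ?_).trans ?_
      · rw [coe_toNNReal_mul h₁.le]; linarith
      · rw [coe_toNNReal_mul h₁.le]
        have : Real.exp (-(m₁ * (p i).toReal) / 8) ≤ Real.exp (-t / 4) :=
          Real.exp_le_exp.2 (by linarith)
        have : 0 ≤ m₂ * (2 * m₂ * t / m₁) ^ 2 * (p i).toReal := by positivity
        linarith
  refine (measureReal_exists_le _ hi).trans (le_of_eq ?_)
  rw [Finset.sum_add_distrib, ← Finset.mul_sum, sum_toReal_eq_one]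
  simp

end Events

/-! ### Acceptance, rejection and sample sizes. -/

section Tests

variable {n : ℕ} (p q : PMF (Fin n)) {m₁ m₂ : ℝ}

lemma ofReal_le_dataProb (h₁ : 0 ≤ m₁) (h₂ : 0 ≤ m₂)
    (F : Set ((Fin n → ℕ × ℕ) × (Fin n → ℕ × ℕ))) {d : ℝ} (E : Set (Samples n))
    (hF : ((countMeasure p q m₁ m₂).prod (countMeasure p q m₁ m₂)).real F ≤ d)
    (hE : ∀ s : Samples n, s.counts ∉ F → s ∈ E) :
    ENNReal.ofReal (1 - d) ≤ dataProb p q m₁ m₂ E := by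
  have h : dataProb p q m₁ m₂ {s | s.counts ∈ Fᶜ} ≤ dataProb p q m₁ m₂ E :=
    measure_mono fun s hs => hE s hs
  refine le_trans ?_ h
  rw [dataProb_counts_preimage p q h₁ h₂]
  refine ENNReal.ofReal_le_of_le_toReal ?_
  have := probReal_compl_eq_one_sub (μ := (countMeasure p q m₁ m₂).prod (countMeasure p q m₁ m₂))
    (s := F) MeasurableSet.of_discrete
  rw [measureReal_def] at this
  rw [this]; linarith

lemma measureReal_first_batch (S : Set (Fin n → ℕ × ℕ)) :
    ((countMeasure p q m₁ m₂).prod (countMeasure p q m₁ m₂)).real {x | x.1 ∈ S} =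
      (countMeasure p q m₁ m₂).real S :=
  measurePreserving_fst.measureReal_preimage MeasurableSet.of_discrete.nullMeasurableSet

lemma measureReal_second_batch (S : Set (Fin n → ℕ × ℕ)) :
    ((countMeasure p q m₁ m₂).prod (countMeasure p q m₁ m₂)).real {x | x.2 ∈ S} =
      (countMeasure p q m₁ m₂).real S :=
  measurePreserving_snd.measureReal_preimage MeasurableSet.of_discrete.nullMeasurableSet

lemma statR_le_univ (s : Samples n) (A : Finset (Fin n)) :
    statR s A ≤ ∑ i, (if (s.counts.2 i).2 = 2 then (1 : ℝ) else 0) /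
      (((s.counts.2 i).1 : ℝ) + 1) :=
  Finset.sum_le_univ_sum_of_nonneg fun i => by positivity

lemma statV_le_deviation (s : Samples n) (A : Finset (Fin n)) :
    statV m₁ m₂ s A ≤ ∑ i ∈ A, (|((s.counts.2 i).1 : ℝ) / m₁ - (p i).toReal| +
      |((s.counts.2 i).2 : ℝ) / m₂ - (p i).toReal|) := by
  refine Finset.sum_le_sum fun i _ => ?_
  rw [abs_sub_comm (((s.counts.2 i).2 : ℝ) / m₂)]
  exact abs_sub_le _ _ _

lemma l1_sub_deviation_le_statV (s : Samples n) (A : Finset (Fin n)) :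
    ∑ i ∈ A, |(p i).toReal - (q i).toReal| -
      ∑ i ∈ A, (|((s.counts.2 i).1 : ℝ) / m₁ - (p i).toReal| +
        |((s.counts.2 i).2 : ℝ) / m₂ - (q i).toReal|) ≤ statV m₁ m₂ s A := by
  rw [sub_le_iff_le_add', statV, ← Finset.sum_add_distrib]
  refine Finset.sum_le_sum fun i _ => ?_
  change _ ≤ |((s.counts.2 i).1 : ℝ) / m₁ - (p i).toReal| +
        |((s.counts.2 i).2 : ℝ) / m₂ - (q i).toReal| +
        |((s.counts.2 i).1 : ℝ) / m₁ - ((s.counts.2 i).2 : ℝ) / m₂|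
  have a := abs_sub_le (p i).toReal (((s.counts.2 i).1 : ℝ) / m₁) (q i).toReal
  have c := abs_sub_le (((s.counts.2 i).1 : ℝ) / m₁) (((s.counts.2 i).2 : ℝ) / m₂) (q i).toReal
  rw [abs_sub_comm (p i).toReal (((s.counts.2 i).1 : ℝ) / m₁)] at a
  linarith

/-- Chebyshev for `W` at half its mean `w`, with `β = b`. Both quotients decrease in `w`, so its
lower bound, twice the threshold, is the worst case. -/
lemma medium_failure_bound {ε : ℝ} {ℓ : ℝ} (hε : 0 < ε) (hℓ : 0 < ℓ) (h₁ : 0 < m₁) (h₂ : 0 < m₂)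
    (hW : 64 * 256 / (ε ^ 6 * m₂ * ℓ) ≤ 1 / 100) (hW' : 64 * 256 / (ε ^ 4 * m₂) ≤ 1 / 100)
    {w : ℝ} (hw : ε ^ 2 * m₁ ^ 2 * m₂ * ℓ ≤ w) :
    (16 * (256 * ℓ / (ε ^ 2 * m₂)) * m₁ ^ 2 * m₂ * w +
      16 * (256 * ℓ / (ε ^ 2 * m₂)) * m₁ ^ 4 * m₂ ^ 2) / (w / 2) ^ 2 ≤ 1 / 50 := by
  have hw0 : 0 < w := lt_of_lt_of_le (by positivity) hw
  have e1 : 16 * (256 * ℓ / (ε ^ 2 * m₂)) * m₁ ^ 2 * m₂ * w / (w / 2) ^ 2 ≤ 1 / 100 := by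
    refine le_trans ?_ hW'
    rw [div_le_div_iff₀ (by positivity) (by positivity)]
    have : 16 * (256 * ℓ / (ε ^ 2 * m₂)) * m₁ ^ 2 * m₂ * w * (ε ^ 4 * m₂) =
      16 * 256 * w * (ε ^ 2 * m₁ ^ 2 * m₂ * ℓ) := by field_simp
    rw [this]
    calc 16 * 256 * w * (ε ^ 2 * m₁ ^ 2 * m₂ * ℓ) ≤ 16 * 256 * w * w := by gcongr
      _ = _ := by ring
  have e2 : 16 * (256 * ℓ / (ε ^ 2 * m₂)) * m₁ ^ 4 * m₂ ^ 2 / (w / 2) ^ 2 ≤ 1 / 100 := by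
    refine le_trans ?_ hW
    rw [div_le_div_iff₀ (by positivity) (by positivity)]
    have : 16 * (256 * ℓ / (ε ^ 2 * m₂)) * m₁ ^ 4 * m₂ ^ 2 * (ε ^ 6 * m₂ * ℓ) =
      16 * 256 * (ε ^ 2 * m₁ ^ 2 * m₂ * ℓ) ^ 2 := by field_simp
    rw [this]
    calc 16 * 256 * (ε ^ 2 * m₁ ^ 2 * m₂ * ℓ) ^ 2 ≤ 16 * 256 * w ^ 2 := by gcongr
      _ = _ := by ring
  rw [add_div]; linarith

/-- The tester accepts with good probability if the distributions agree. -/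
lemma accept_of_eq {ε : ℝ} (hε : 0 < ε) (hn : 0 < Real.log n) (h₂ : 0 < m₂) (h₁₂ : m₂ ≤ m₁)
    (hX : m₂ * (2 * m₂ * (m₁ * ε ^ (2 / 3 : ℝ) / (10 * m₂ * (n : ℝ) ^ (1 / 3 : ℝ))) / m₁) ^ 2 +
      n * Real.exp (-(m₁ * ε ^ (2 / 3 : ℝ) / (10 * m₂ * (n : ℝ) ^ (1 / 3 : ℝ))) / 4) ≤ 1 / 50)
    (hV : 4 / √(b n ε m₂ * m₂) / (ε / 6) ≤ 1 / 50)
    (hG : 2 * n * Real.exp (-(b n ε m₂ * m₂) / 4) ≤ 1 / 50)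
    (hW : 64 * 256 / (ε ^ 6 * m₂ * Real.log n) ≤ 1 / 100) :
    2 / 3 ≤ dataProb p p m₁ m₂
      {s | extremeTest ε m₁ m₂ 40 10 s = Verdict.accept} := by
  have h₁ : 0 < m₁ := h₂.trans_le h₁₂
  have hb : 0 < b n ε m₂ := by unfold b; positivity
  set τ := m₁ * ε ^ (2 / 3 : ℝ) / (10 * m₂ * (n : ℝ) ^ (1 / 3 : ℝ)) with hτ
  set Q := countMeasure p p m₁ m₂ with hQ
  let FX : Set ((Fin n → ℕ × ℕ) × (Fin n → ℕ × ℕ)) :=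
    {x | x.2 ∈ {w : Fin n → ℕ × ℕ | ∃ i, 3 ≤ (w i).2 ∧ ((w i).1 : ℝ) ≤ τ}}
  let FR : Set ((Fin n → ℕ × ℕ) × (Fin n → ℕ × ℕ)) :=
    {x | x.2 ∈ {w : Fin n → ℕ × ℕ | 10 * (m₂ ^ 2 / m₁) ≤
      ∑ i, (if (w i).2 = 2 then (1 : ℝ) else 0) / (((w i).1 : ℝ) + 1)}}
  let FV : Set ((Fin n → ℕ × ℕ) × (Fin n → ℕ × ℕ)) :=
    {x | ε / 6 ≤ ∑ i ∈ heavyCounts ε m₁ m₂ x.1, (|((x.2 i).1 : ℝ) / m₁ - (p i).toReal| +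
        |((x.2 i).2 : ℝ) / m₂ - (p i).toReal|)}
  let G : Set (Fin n → ℕ × ℕ) := {z | ∃ i, i ∈ mediumCounts ε m₁ m₂ z ∧
      (2 * b n ε m₂ < (p i).toReal ∨ 2 * b n ε m₂ < (p i).toReal)}
  let FW : Set ((Fin n → ℕ × ℕ) × (Fin n → ℕ × ℕ)) :=
    {x | x.1 ∉ G ∧ ε ^ 2 * m₁ ^ 2 * m₂ * Real.log n / 2 ≤
      ∑ i ∈ mediumCounts ε m₁ m₂ x.1, centeredSq m₂ m₁ (x.2 i)}
  let FZ : Set ((Fin n → ℕ × ℕ) × (Fin n → ℕ × ℕ)) :=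
    {x | 40 * m₁ ^ (3 / 2 : ℝ) * m₂ ≤ ∑ i ∈ lightCounts ε m₁ m₂ x.1,
      centeredSq m₂ m₁ (x.2 i) / (((x.2 i).1 : ℝ) + (x.2 i).2)}
  have bX : (Q.prod Q).real FX ≤ 1 / 50 := by
    rw [measureReal_second_batch]
    exact (measureReal_exists_three_le p h₁ h₂ τ).trans hX
  have bR : (Q.prod Q).real FR ≤ 1 / 20 := by
    rw [measureReal_second_batch]
    exact measureReal_statR_le p h₁ h₂
  have bV : (Q.prod Q).real FV ≤ 1 / 50 :=
    (measureReal_heavy_deviation_le p p h₂ h₁₂ hb (by positivity)).trans hV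
  have bG : (Q.prod Q).real {x | x.1 ∈ G} ≤ 1 / 50 := by
    rw [measureReal_first_batch]
    exact (measureReal_medium_large_le p p h₂ h₁₂).trans hG
  have bW : (Q.prod Q).real FW ≤ 1 / 50 := by
    refine prod_measureReal_le_of_forall _ (by norm_num) fun z => ?_
    by_cases hz : z ∈ G
    · simp [FW, hz]
    · have hz' : ∀ i ∈ mediumCounts ε m₁ m₂ z, (p i).toReal ≤ 2 * b n ε m₂ := fun i hi => by
        by_contra! h; exact hz ⟨i, hi, Or.inl h⟩
      have hc := measureReal_statW_deviation_le p p h₁ h₂ h₁₂ (mediumCounts ε m₁ m₂ z) hz' hz' hb.le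
        (t := ε ^ 2 * m₁ ^ 2 * m₂ * Real.log n / 2) (by positivity)
      simp only [sub_self, ne_eq, OfNat.ofNat_ne_zero, not_false_eq_true, zero_pow, mul_zero,
        Finset.sum_const_zero, sub_zero, zero_add] at hc
      refine (measureReal_mono fun w hw => ?_).trans (hc.trans ?_)
      · exact hw.2.trans (le_abs_self _)
      · refine le_trans (le_of_eq ?_) (hW.trans (by norm_num))
        unfold b; field_simp; norm_num
  have bZ : (Q.prod Q).real FZ ≤ 1 / 100 := by
    refine prod_measureReal_le_of_forall _ (by norm_num) fun z => ?_
    obtain ⟨e, -, he, hc⟩ := exists_measureReal_statZ_deviation_le p p h₁ h₂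
      (lightCounts ε m₁ m₂ z)
    have hc := hc (40 * m₁ ^ (3 / 2 : ℝ) * m₂) (by positivity)
    have he' : ∀ i, e i = 0 := fun i => he i rfl
    simp only [he', Finset.sum_const_zero, sub_zero, mul_zero, zero_add] at hc
    refine (measureReal_mono fun w hw => ?_).trans (hc.trans ?_)
    · simp only [FZ, Set.mem_ofPred_eq] at hw ⊢
      exact hw.trans (le_abs_self _)
    -- With mean 0 and `m₂ ≤ m₁` the variance is at most `16 m₁³ m₂²`, and the squared threshold is
    -- `1600 m₁³ m₂²`; this fixes the constant 40.
    · rw [div_le_div_iff₀ (by positivity) (by norm_num)]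
      have e3 : (m₁ ^ (3 / 2 : ℝ)) ^ 2 = m₁ ^ 3 := by
        rw [← Real.rpow_natCast, ← Real.rpow_mul h₁.le, ← Real.rpow_natCast]; norm_num
      have : (m₁ + m₂) ^ 2 ≤ (2 * m₁) ^ 2 := by gcongr; linarith
      calc 4 * (m₁ + m₂) ^ 2 * m₂ ^ 2 * m₁ * 100 ≤ 4 * (2 * m₁) ^ 2 * m₂ ^ 2 * m₁ * 100 := by
            gcongr
        _ = 1 * (40 ^ 2 * (m₁ ^ 3) * m₂ ^ 2) := by ring
        _ = _ := by rw [← e3]; ring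
  have bF : (Q.prod Q).real (FX ∪ FR ∪ FV ∪ {x | x.1 ∈ G} ∪ FW ∪ FZ) ≤ 1 / 3 := by
    have u1 := measureReal_union_le (μ := Q.prod Q) (FX ∪ FR ∪ FV ∪ {x | x.1 ∈ G} ∪ FW) FZ
    have u2 := measureReal_union_le (μ := Q.prod Q) (FX ∪ FR ∪ FV ∪ {x | x.1 ∈ G}) FW
    have u3 := measureReal_union_le (μ := Q.prod Q) (FX ∪ FR ∪ FV) {x | x.1 ∈ G}
    have u4 := measureReal_union_le (μ := Q.prod Q) (FX ∪ FR) FV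
    have u5 := measureReal_union_le (μ := Q.prod Q) FX FR
    linarith
  have e23 : ENNReal.ofReal (1 - 1 / 3) = 2 / 3 := by
    rw [show (1 - 1 / 3 : ℝ) = 2 / 3 by norm_num, ENNReal.ofReal_div_of_pos (by norm_num)]
    simp
  rw [← e23]
  refine ofReal_le_dataProb p p h₁.le h₂.le _ _ bF fun s hs => ?_
  simp only [Set.mem_union, not_or] at hs
  obtain ⟨⟨⟨⟨⟨hX, hR⟩, hV⟩, hG⟩, hW⟩, hZ⟩ := hs
  have hG : s.counts.1 ∉ G := hG
  rw [Set.mem_ofPred_eq, extremeTest, if_neg, if_pos]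
  · refine ⟨?_, ?_, ?_, ?_⟩
    · exact (statR_le_univ s _).trans (not_le.1 hR).le
    · exact (statV_le_deviation p s _).trans (not_le.1 hV).le
    · rw [statW_eq, medium_eq_mediumCounts]
      by_contra! h
      exact hW ⟨hG, h.le⟩
    · rw [statZ_eq, light_eq_lightCounts]
      exact (not_le.1 hZ).le
  · rintro ⟨i, hi⟩
    exact hX ⟨i, hi⟩

/-- Chebyshev for `Z` at half its mean `E`, where `g = m₁^(3/2) m₂`. The variance is at most `gE/5 +
16 g² ≤ E²/200`; the bound `200 m₁² ≤ g` controls the part proportional to the mean. -/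
lemma light_failure_bound {E g : ℝ} (h₁ : 0 < m₁) (h₂ : 0 < m₂) (h₁₂ : m₂ ≤ m₁) (hg : 0 < g)
    (hg2 : g ^ 2 = m₁ ^ 3 * m₂ ^ 2) (hg3 : 200 * m₁ ^ 2 ≤ g) (hE : 80 * g ≤ E) :
    (10 * (m₁ + m₂) ^ 2 * E + 4 * (m₁ + m₂) ^ 2 * m₂ ^ 2 * m₁) / (E / 2) ^ 2 ≤ 1 / 50 := by
  have hE0 : 0 < E := lt_of_lt_of_le (by positivity) hE
  rw [div_le_div_iff₀ (by positivity) (by norm_num)]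
  have hT : (m₁ + m₂) ^ 2 ≤ (2 * m₁) ^ 2 := by gcongr; linarith
  have s1 : 10 * (m₁ + m₂) ^ 2 * E ≤ 1 / 5 * g * E := by
    refine mul_le_mul_of_nonneg_right ?_ hE0.le
    nlinarith
  have s2 : 4 * (m₁ + m₂) ^ 2 * m₂ ^ 2 * m₁ ≤ 16 * g ^ 2 := by
    calc 4 * (m₁ + m₂) ^ 2 * m₂ ^ 2 * m₁ ≤ 4 * (2 * m₁) ^ 2 * m₂ ^ 2 * m₁ := by gcongr
      _ = 16 * (m₁ ^ 3 * m₂ ^ 2) := by ring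
      _ = _ := by rw [hg2]
  nlinarith [mul_le_mul_of_nonneg_right hE hE0.le, mul_le_mul_of_nonneg_right hE hg.le]

/-- The tester rejects with good probability if the distributions are far apart. -/
lemma reject_of_far {ε C : ℝ} (hε : 0 < ε) (hn : 0 < Real.log n) (h₂ : 0 < m₂) (h₁₂ : m₂ ≤ m₁)
    (hV : 4 / √(b n ε m₂ * m₂) / (ε / 6) ≤ 1 / 50)
    (hG : 2 * n * Real.exp (-(b n ε m₂ * m₂) / 4) ≤ 1 / 50)
    (hW : 64 * 256 / (ε ^ 6 * m₂ * Real.log n) ≤ 1 / 100)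
    (hW' : 64 * 256 / (ε ^ 4 * m₂) ≤ 1 / 100)
    (hZ : 80 * (m₁ ^ (3 / 2 : ℝ) * m₂) * (2 * n + m₁ + m₂) ≤ m₁ ^ 2 * m₂ ^ 2 * (ε / 3) ^ 2)
    (hZ' : 200 * √m₁ ≤ m₂) (hpq : ε ≤ l1Dist p q) :
    2 / 3 ≤ dataProb p q m₁ m₂
      {s | extremeTest ε m₁ m₂ 40 C s = Verdict.reject} := by
  have h₁ : 0 < m₁ := h₂.trans_le h₁₂
  have hb : 0 < b n ε m₂ := by unfold b; positivity
  have hb' : 0 < b' n m₂ := by unfold b'; positivity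
  set Q := countMeasure p q m₁ m₂ with hQ
  let D : Finset (Fin n) → ℝ := fun A => ∑ i ∈ A, |(p i).toReal - (q i).toReal|
  let FV : Set ((Fin n → ℕ × ℕ) × (Fin n → ℕ × ℕ)) :=
    {x | ε / 6 ≤ ∑ i ∈ heavyCounts ε m₁ m₂ x.1, (|((x.2 i).1 : ℝ) / m₁ - (p i).toReal| +
        |((x.2 i).2 : ℝ) / m₂ - (q i).toReal|)}
  let G : Set (Fin n → ℕ × ℕ) := {z | ∃ i, i ∈ mediumCounts ε m₁ m₂ z ∧
      (2 * b n ε m₂ < (p i).toReal ∨ 2 * b n ε m₂ < (q i).toReal)}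
  let FM : Set (Fin n → ℕ × ℕ) := {z | 25 / b' n m₂ ≤ ((mediumCounts ε m₁ m₂ z).card : ℝ)}
  let FW : Set ((Fin n → ℕ × ℕ) × (Fin n → ℕ × ℕ)) :=
    {x | (x.1 ∉ G ∧ x.1 ∉ FM ∧ ε / 3 ≤ D (mediumCounts ε m₁ m₂ x.1)) ∧
      ∑ i ∈ mediumCounts ε m₁ m₂ x.1, centeredSq m₂ m₁ (x.2 i) ≤
        ε ^ 2 * m₁ ^ 2 * m₂ * Real.log n / 2}
  let FZ : Set ((Fin n → ℕ × ℕ) × (Fin n → ℕ × ℕ)) :=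
    {x | ε / 3 ≤ D (lightCounts ε m₁ m₂ x.1) ∧ ∑ i ∈ lightCounts ε m₁ m₂ x.1,
      centeredSq m₂ m₁ (x.2 i) / (((x.2 i).1 : ℝ) + (x.2 i).2) ≤ 40 * m₁ ^ (3 / 2 : ℝ) * m₂}
  have bV : (Q.prod Q).real FV ≤ 1 / 50 :=
    (measureReal_heavy_deviation_le p q h₂ h₁₂ hb (by positivity)).trans hV
  have bG : (Q.prod Q).real {x | x.1 ∈ G} ≤ 1 / 50 := by
    rw [measureReal_first_batch]
    exact (measureReal_medium_large_le p q h₂ h₁₂).trans hG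
  have bM : (Q.prod Q).real {x | x.1 ∈ FM} ≤ 2 / 25 := by
    rw [measureReal_first_batch]
    exact measureReal_card_medium_le p q h₁ h₂ hb'
  have bW : (Q.prod Q).real FW ≤ 1 / 50 := by
    refine prod_measureReal_le_of_forall _ (by norm_num) fun z => ?_
    by_cases hz : z ∉ G ∧ z ∉ FM ∧ ε / 3 ≤ D (mediumCounts ε m₁ m₂ z)
    · obtain ⟨hzG, hzM, hzD⟩ := hz
      have hz1 : ∀ i ∈ mediumCounts ε m₁ m₂ z, (p i).toReal ≤ 2 * b n ε m₂ := fun i hi => by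
        by_contra! h; exact hzG ⟨i, hi, Or.inl h⟩
      have hz2 : ∀ i ∈ mediumCounts ε m₁ m₂ z, (q i).toReal ≤ 2 * b n ε m₂ := fun i hi => by
        by_contra! h; exact hzG ⟨i, hi, Or.inr h⟩
      have hcard : ((mediumCounts ε m₁ m₂ z).card : ℝ) ≤ 25 / b' n m₂ := (not_le.1 hzM).le
      set A := mediumCounts ε m₁ m₂ z
      set S := ∑ i ∈ A, m₁ ^ 2 * m₂ ^ 2 * ((p i).toReal - (q i).toReal) ^ 2 with hS
      -- Cauchy–Schwarz over the medium set; the constant 256 in `b'` is just above `9 · 25`, from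
      -- `(ε/3)²` and the cardinality bound.
      have hSlow : ε ^ 2 * m₁ ^ 2 * m₂ * Real.log n ≤ S := by
        have cs := sq_sum_le_card_mul_sum_sq (s := A)
          (f := fun i => |(p i).toReal - (q i).toReal|)
        simp only [sq_abs] at cs
        have hD2 : (ε / 3) ^ 2 ≤ (D A) ^ 2 := by gcongr
        have n0 : 0 ≤ ∑ i ∈ A, ((p i).toReal - (q i).toReal) ^ 2 :=
          Finset.sum_nonneg fun i _ => sq_nonneg _
        have k1 : (ε / 3) ^ 2 ≤ 25 / b' n m₂ * ∑ i ∈ A, ((p i).toReal - (q i).toReal) ^ 2 :=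
          hD2.trans (cs.trans (mul_le_mul_of_nonneg_right hcard n0))
        rw [hS, ← Finset.mul_sum]
        set X := ∑ i ∈ A, ((p i).toReal - (q i).toReal) ^ 2
        have k2 : (ε / 3) ^ 2 * b' n m₂ ≤ 25 * X := by
          have := mul_le_mul_of_nonneg_right k1 hb'.le
          calc _ ≤ _ := this
            _ = _ := by field_simp
        unfold b' at k2
        have k3 : ε ^ 2 * Real.log n / m₂ ≤ X := by
          have e1 : (ε / 3) ^ 2 * (256 * Real.log n / m₂) =
            256 / 9 * (ε ^ 2 * Real.log n / m₂) := by ring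
          have : 0 ≤ ε ^ 2 * Real.log n / m₂ := by positivity
          linarith
        calc ε ^ 2 * m₁ ^ 2 * m₂ * Real.log n
            = m₁ ^ 2 * m₂ ^ 2 * (ε ^ 2 * Real.log n / m₂) := by field_simp
          _ ≤ _ := by gcongr
      have hS0 : 0 < S := lt_of_lt_of_le (by positivity) hSlow
      have hc := measureReal_statW_deviation_le p q h₁ h₂ h₁₂ A hz1 hz2 hb.le
        (t := S / 2) (by positivity)
      refine (measureReal_mono fun w hw => ?_).trans (hc.trans ?_)
      · have hw := hw.2
        simp only [Set.mem_ofPred_eq] at hw ⊢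
        rw [abs_sub_comm]
        refine le_trans ?_ (le_abs_self _)
        linarith
      · exact medium_failure_bound hε hn h₁ h₂ hW hW' hSlow
    · simp [FW, hz]
  have bZ : (Q.prod Q).real FZ ≤ 1 / 50 := by
    refine prod_measureReal_le_of_forall _ (by norm_num) fun z => ?_
    by_cases hz : ε / 3 ≤ D (lightCounts ε m₁ m₂ z)
    · set A := lightCounts ε m₁ m₂ z
      obtain ⟨e, he, -, hc⟩ := exists_measureReal_statZ_deviation_le p q h₁ h₂ A
      set g := m₁ ^ (3 / 2 : ℝ) * m₂ with hg
      have hg0 : 0 < g := by positivity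
      have hg2 : g ^ 2 = m₁ ^ 3 * m₂ ^ 2 := by
        rw [hg, mul_pow, ← Real.rpow_natCast (m₁ ^ _), ← Real.rpow_mul h₁.le,
          ← Real.rpow_natCast]; norm_num
      have hg3 : 200 * m₁ ^ 2 ≤ g := by
        have e1 : m₁ ^ (3 / 2 : ℝ) = m₁ * √m₁ := by
          rw [Real.sqrt_eq_rpow]
          nth_rw 2 [← Real.rpow_one m₁]
          rw [← Real.rpow_add h₁]; norm_num
        rw [hg, e1]
        have e2 := Real.mul_self_sqrt h₁.le
        calc 200 * m₁ ^ 2 = m₁ * √m₁ * (200 * √m₁) := by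
              rw [show m₁ * √m₁ * (200 * √m₁) = 200 * m₁ * (√m₁ * √m₁) by ring, e2]; ring
          _ ≤ _ := by gcongr
      have hΛ : ∀ i, 0 < m₁ * (p i).toReal + m₂ * (q i).toReal + 2 := fun i => by positivity
      have hE : 80 * g ≤ ∑ i ∈ A, e i := by
        refine le_trans ?_ (Finset.sum_le_sum fun i _ => he i)
        -- Weighted Cauchy–Schwarz with the denominators of the lower bound for the means. It holds
        -- on every set, so no bound on `p_i`, `q_i` over `H` is needed.
        have cs := Finset.sum_sq_le_sum_mul_sum_of_sq_le_mul A
          (r := fun i => |(p i).toReal - (q i).toReal|)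
          (f := fun i => ((p i).toReal - (q i).toReal) ^ 2 /
            (m₁ * (p i).toReal + m₂ * (q i).toReal + 2))
          (g := fun i => m₁ * (p i).toReal + m₂ * (q i).toReal + 2)
          (fun i _ => div_nonneg (sq_nonneg _) (hΛ i).le) (fun i _ => (hΛ i).le)
          (fun i _ => by rw [sq_abs, div_mul_cancel₀ _ (hΛ i).ne'])
        have hsum : ∑ i ∈ A, (m₁ * (p i).toReal + m₂ * (q i).toReal + 2) ≤ 2 * n + m₁ + m₂ := by
          refine (Finset.sum_le_univ_sum_of_nonneg fun i => (hΛ i).le).trans (le_of_eq ?_)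
          rw [Finset.sum_add_distrib, Finset.sum_add_distrib, ← Finset.mul_sum, ← Finset.mul_sum,
            sum_toReal_eq_one, sum_toReal_eq_one]
          simp; ring
        set S := ∑ i ∈ A, ((p i).toReal - (q i).toReal) ^ 2 /
            (m₁ * (p i).toReal + m₂ * (q i).toReal + 2) with hS
        have hS0 : 0 ≤ S := Finset.sum_nonneg fun i _ => div_nonneg (sq_nonneg _) (hΛ i).le
        have hD2 : (ε / 3) ^ 2 ≤ (D A) ^ 2 := by gcongr
        have k1 : (ε / 3) ^ 2 ≤ S * (2 * n + m₁ + m₂) :=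
          hD2.trans (cs.trans (mul_le_mul_of_nonneg_left hsum hS0))
        have hpos : 0 < 2 * (n : ℝ) + m₁ + m₂ := by positivity
        have k2 : 80 * g ≤ m₁ ^ 2 * m₂ ^ 2 * S := by
          refine le_of_mul_le_mul_right ?_ hpos
          calc 80 * g * (2 * n + m₁ + m₂) ≤ m₁ ^ 2 * m₂ ^ 2 * (ε / 3) ^ 2 := hZ
            _ ≤ m₁ ^ 2 * m₂ ^ 2 * (S * (2 * n + m₁ + m₂)) := by gcongr
            _ = _ := by ring
        refine k2.trans (le_of_eq ?_)
        rw [hS, Finset.mul_sum]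
        exact Finset.sum_congr rfl fun i _ => by ring
      have hE0 : 0 < ∑ i ∈ A, e i := lt_of_lt_of_le (by positivity) hE
      refine (measureReal_mono fun w hw => ?_).trans ((hc ((∑ i ∈ A, e i) / 2)
        (by positivity)).trans (light_failure_bound h₁ h₂ h₁₂ hg0 hg2 hg3 hE))
      have hw := hw.2
      simp only [Set.mem_ofPred_eq] at hw ⊢
      rw [abs_sub_comm]
      refine le_trans ?_ (le_abs_self _)
      rw [mul_assoc, ← hg] at hw
      linarith
    · simp [FZ, hz]
  have bF : (Q.prod Q).real (FV ∪ {x | x.1 ∈ G} ∪ {x | x.1 ∈ FM} ∪ FW ∪ FZ) ≤ 1 / 3 := by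
    have u1 := measureReal_union_le (μ := Q.prod Q) (FV ∪ {x | x.1 ∈ G} ∪ {x | x.1 ∈ FM} ∪ FW) FZ
    have u2 := measureReal_union_le (μ := Q.prod Q) (FV ∪ {x | x.1 ∈ G} ∪ {x | x.1 ∈ FM}) FW
    have u3 := measureReal_union_le (μ := Q.prod Q) (FV ∪ {x | x.1 ∈ G}) {x | x.1 ∈ FM}
    have u4 := measureReal_union_le (μ := Q.prod Q) FV {x | x.1 ∈ G}
    linarith
  have e23 : ENNReal.ofReal (1 - 1 / 3) = 2 / 3 := by
    rw [show (1 - 1 / 3 : ℝ) = 2 / 3 by norm_num, ENNReal.ofReal_div_of_pos (by norm_num)]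
    simp
  rw [← e23]
  refine ofReal_le_dataProb p q h₁.le h₂.le _ _ bF fun s hs => ?_
  simp only [Set.mem_union, not_or] at hs
  obtain ⟨⟨⟨⟨hV, hG⟩, hM⟩, hW⟩, hZ⟩ := hs
  have hG : s.counts.1 ∉ G := hG
  have hM : s.counts.1 ∉ FM := hM
  simp only [FV, Set.mem_ofPred_eq, not_le] at hV
  rw [Set.mem_ofPred_eq, extremeTest]
  split_ifs with c1 c2
  · rfl
  · exfalso
    obtain ⟨-, tV, tW, tZ⟩ := c2
    rw [heavy_eq_heavyCounts] at tV
    rw [statW_eq, medium_eq_mediumCounts] at tW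
    rw [statZ_eq, light_eq_lightCounts] at tZ
    -- If all statistics passed, each of the three sets would carry less than `ε/3`, contradicting
    -- the distance.
    have d1 : D (heavyCounts ε m₁ m₂ s.counts.1) < ε / 3 := by
      have := l1_sub_deviation_le_statV p q (m₁ := m₁) (m₂ := m₂) s
        (heavyCounts ε m₁ m₂ s.counts.1)
      linarith
    have d2 : D (mediumCounts ε m₁ m₂ s.counts.1) < ε / 3 := by
      by_contra! h
      exact hW ⟨⟨hG, hM, h⟩, tW⟩
    have d3 : D (lightCounts ε m₁ m₂ s.counts.1) < ε / 3 := by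
      by_contra! h
      exact hZ ⟨h, tZ⟩
    have d4 : l1Dist p q = D (heavyCounts ε m₁ m₂ s.counts.1 ∪ mediumCounts ε m₁ m₂ s.counts.1) +
        D (lightCounts ε m₁ m₂ s.counts.1) := (Finset.sum_add_sum_compl _ _).symm
    have d5 : D (heavyCounts ε m₁ m₂ s.counts.1 ∪ mediumCounts ε m₁ m₂ s.counts.1) ≤
        D (heavyCounts ε m₁ m₂ s.counts.1) + D (mediumCounts ε m₁ m₂ s.counts.1) := by
      rw [← Finset.sum_union_inter]
      exact le_add_of_nonneg_right (Finset.sum_nonneg fun i _ => abs_nonneg _)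
    linarith
  · rfl

lemma sum_count_eq_length {n : ℕ} (l : List (Fin n)) : ∑ i, (l.count i : ℝ) = l.length := by
  induction l with
  | nil => simp
  | cons a l ih =>
    simp only [List.count_cons, Nat.cast_add, Finset.sum_add_distrib, ih, List.length_cons]
    simp

/-- The numbers of samples are of the order of their means. -/
lemma sample_sizes {r : ℝ} (h₁ : 0 < m₁) (h₂ : 0 < m₂) (hr : m₂ ≤ r) (h₁' : 1600 ≤ m₁)
    (hr' : 1600 ≤ r) :
    99 / 100 ≤ dataProb p q m₁ m₂
      {s | m₁ ≤ s.numP ∧ (s.numP : ℝ) ≤ 3 * m₁ ∧ (s.numQ : ℝ) ≤ 3 * r} := by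
  set Q := countMeasure p q m₁ m₂ with hQ
  let A : Set (Fin n → ℕ × ℕ) := {w | m₁ / 2 ≤ |∑ i, ((w i).1 : ℝ) - m₁|}
  -- The deviation is measured against `r` rather than `m₂`: only an upper bound on the size is
  -- wanted, and two batches then total less than `2 m₂ + r ≤ 3r`.
  let B : Set (Fin n → ℕ × ℕ) := {w | r / 2 ≤ |∑ i, ((w i).2 : ℝ) - m₂|}
  have bA : Q.real A ≤ 1 / 400 := by
    refine (measureReal_sum_fst_le p q h₁ (by positivity)).trans ?_
    rw [div_le_div_iff₀ (by positivity) (by norm_num)]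
    nlinarith
  have bB : Q.real B ≤ 1 / 400 := by
    have hr0 : 0 < r := by linarith
    refine (measureReal_sum_snd_le p q h₂ (by positivity)).trans ?_
    rw [div_le_div_iff₀ (by positivity) (by norm_num)]
    nlinarith
  have bF : (Q.prod Q).real ({x | x.1 ∈ A} ∪ {x | x.2 ∈ A} ∪ {x | x.1 ∈ B} ∪ {x | x.2 ∈ B}) ≤
      1 / 100 := by
    have u1 := measureReal_union_le (μ := Q.prod Q)
      ({x | x.1 ∈ A} ∪ {x | x.2 ∈ A} ∪ {x | x.1 ∈ B}) {x | x.2 ∈ B}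
    have u2 := measureReal_union_le (μ := Q.prod Q)
      ({x | x.1 ∈ A} ∪ {x | x.2 ∈ A}) {x | x.1 ∈ B}
    have u3 := measureReal_union_le (μ := Q.prod Q) {x | x.1 ∈ A} {x | x.2 ∈ A}
    rw [measureReal_first_batch, measureReal_second_batch] at u3
    rw [measureReal_first_batch] at u2
    rw [measureReal_second_batch] at u1
    linarith
  have e99 : ENNReal.ofReal (1 - 1 / 100) = 99 / 100 := by
    rw [show (1 - 1 / 100 : ℝ) = 99 / 100 by norm_num, ENNReal.ofReal_div_of_pos (by norm_num)]
    simp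
  rw [← e99]
  refine ofReal_le_dataProb p q h₁.le h₂.le _ _ bF fun s hs => ?_
  simp only [Set.mem_union, not_or, Set.mem_ofPred_eq, A, B, Samples.counts,
    sum_count_eq_length, not_le] at hs
  obtain ⟨⟨⟨a1, a2⟩, b1⟩, b2⟩ := hs
  rw [abs_lt] at a1 a2 b1 b2
  simp only [Set.mem_ofPred_eq, Samples.numP, Samples.numQ, Nat.cast_add]
  refine ⟨?_, ?_, ?_⟩ <;> linarith

end Tests

/-! ### Asymptotic estimates for the parameters. -/

/-- This is where `γ > 0` pays for the union bound: in the variable `N^(3γ/2)` it is a power against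
an exponential. -/
lemma eventually_mul_exp_neg_rpow_le {κ γ : ℝ} (hκ : 0 < κ) (hγ : 0 < γ) :
    ∀ᶠ N : ℝ in Filter.atTop, 4 * N * Real.exp (-(κ * (N ^ (γ / 2)) ^ 3)) ≤ 1 / 100 := by
  have h1 := (tendsto_rpow_mul_exp_neg_mul_atTop_nhds_zero (2 / (3 * γ)) κ hκ).comp
    (tendsto_rpow_atTop (y := 3 * γ / 2) (by positivity))
  have h2 := h1.const_mul 4
  rw [mul_zero] at h2
  filter_upwards [h2.eventually_le_const (show (0 : ℝ) < 1 / 100 by norm_num),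
    Filter.eventually_gt_atTop 0] with N hN hN0
  refine le_trans (le_of_eq ?_) hN
  simp only [Function.comp]
  rw [← Real.rpow_mul hN0.le, ← Real.rpow_natCast (N ^ (γ / 2)), ← Real.rpow_mul hN0.le]
  have e1 : 3 * γ / 2 * (2 / (3 * γ)) = 1 := by field_simp
  have e2 : γ / 2 * ((3 : ℕ) : ℝ) = 3 * γ / 2 := by push_cast; ring
  rw [e1, e2, Real.rpow_one, neg_mul, mul_assoc]

lemma sqrt_le_one_add {x : ℝ} (hx : 0 ≤ x) : √x ≤ 1 + x := by
  rw [Real.sqrt_le_left (by positivity)]; nlinarith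

lemma div_sq_rpow_third {x ε : ℝ} (hx : 0 ≤ x) (hε : 0 < ε) :
    (x / ε ^ 2) ^ (1 / 3 : ℝ) = x ^ (1 / 3 : ℝ) / ε ^ (2 / 3 : ℝ) := by
  rw [Real.div_rpow hx (by positivity), ← Real.rpow_natCast, ← Real.rpow_mul hε.le]
  norm_num

/-- The relative sizes of the two samples, in terms of `u = (n / ε²) ^ (1 / 9)`. -/
lemma sample_ratio_bounds {u g s m₂ c L' : ℝ} (hu : 0 < u) (hg : 1 ≤ g) (hs : 0 < s)
    (hL : 0 < L') (hc : 0 < c) (h₂ : 0 < m₂) (hsu : √c * u ^ 4 * g ≤ s) (hm : m₂ * s ≤ L' * u ^ 9)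
    (h1 : L' ≤ √c ^ 3 * u ^ 3) (h3 : 4 * L' ≤ √c * u) :
    m₂ ≤ s ^ 2 ∧ m₂ ≤ u ^ 6 / 4 ∧
      √c ^ 3 / (40 * L') * g ^ 3 ≤ s ^ 2 / (10 * m₂ * u ^ 3) / 4 := by
  have hcs : 0 < √c := Real.sqrt_pos.2 hc
  have hsu' : √c * u ^ 4 ≤ s := le_trans (le_mul_of_one_le_right (by positivity) hg) hsu
  refine ⟨?_, ?_, ?_⟩
  · refine le_of_mul_le_mul_right ?_ hs
    calc m₂ * s ≤ L' * u ^ 9 := hm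
      _ ≤ √c ^ 3 * u ^ 3 * u ^ 9 := by gcongr
      _ = (√c * u ^ 4) ^ 3 := by ring
      _ ≤ s ^ 3 := by gcongr
      _ = _ := by ring
  · refine le_of_mul_le_mul_right ?_ hs
    calc m₂ * s ≤ L' * u ^ 9 := hm
      _ = (4 * L') * u ^ 9 / 4 := by ring
      _ ≤ √c * u * u ^ 9 / 4 := by gcongr
      _ = u ^ 6 / 4 * (√c * u ^ 4) := by ring
      _ ≤ u ^ 6 / 4 * s := by gcongr
  -- Here `s³ ≥ √c³ u¹² g³` meets `(m₂ s) u³ ≤ L' u¹²`: the powers of `u` cancel exactly, which is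
  -- the role of `8/9`, and only `g³` is left to grow.
  · rw [div_div, div_mul_eq_mul_div, div_le_div_iff₀ (by positivity) (by positivity)]
    refine le_of_mul_le_mul_right ?_ hs
    calc √c ^ 3 * g ^ 3 * (10 * m₂ * u ^ 3 * 4) * s
        = 40 * (√c ^ 3 * g ^ 3 * u ^ 3) * (m₂ * s) := by ring
      _ ≤ 40 * (√c ^ 3 * g ^ 3 * u ^ 3) * (L' * u ^ 9) := by gcongr
      _ = 40 * L' * (√c * u ^ 4 * g) ^ 3 := by ring
      _ ≤ 40 * L' * s ^ 3 := by gcongr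
      _ = _ := by ring

/-- The thresholds for `n` beyond which all error terms are small. -/
lemma heavy_and_large_bounds {n : ℕ} {ε m₂ : ℝ} (hε : 0 < ε) (hε2 : ε ≤ 2) (h₂ : 0 < m₂)
    (hn : 100 ≤ n) (hlog : 5625 ≤ Real.log n) :
    4 / √(b n ε m₂ * m₂) / (ε / 6) ≤ 1 / 50 ∧
      2 * n * Real.exp (-(b n ε m₂ * m₂) / 4) ≤ 1 / 50 := by
  have hbm : b n ε m₂ * m₂ = 256 * Real.log n / ε ^ 2 := by unfold b; field_simp
  have hl0 : 0 < Real.log n := by linarith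
  have hn0 : (0 : ℝ) < n := by positivity
  constructor
  · have e1 : √(b n ε m₂ * m₂) = 16 * √(Real.log n) / ε := by
      rw [hbm, Real.sqrt_div (by positivity), Real.sqrt_sq hε.le, Real.sqrt_mul (by norm_num)]
      congr 2
      rw [show (256 : ℝ) = 16 ^ 2 by norm_num, Real.sqrt_sq (by norm_num)]
    have e2 : 75 ≤ √(Real.log n) := Real.le_sqrt_of_sq_le (by linarith)
    have e3 : 4 / (16 * √(Real.log n) / ε) / (ε / 6) = 3 / 2 / √(Real.log n) := by
      field_simp; norm_num
    rw [e1, e3, div_le_div_iff₀ (by positivity) (by norm_num)]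
    linarith
  · have e1 : 2 * Real.log n ≤ b n ε m₂ * m₂ / 4 := by
      rw [hbm, div_div, le_div_iff₀ (by positivity)]
      have : ε ^ 2 ≤ 2 ^ 2 := by gcongr
      nlinarith
    have e2 : Real.exp (-(b n ε m₂ * m₂) / 4) ≤ ((n : ℝ) ^ 2)⁻¹ := by
      have : ((n : ℝ) ^ 2)⁻¹ = Real.exp (-(2 * Real.log n)) := by
        rw [Real.exp_neg, mul_comm, Real.exp_mul, Real.exp_log hn0]; norm_num
      rw [this]
      exact Real.exp_le_exp.2 (by linarith)
    calc 2 * n * Real.exp (-(b n ε m₂ * m₂) / 4) ≤ 2 * n * ((n : ℝ) ^ 2)⁻¹ := by gcongr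
      _ = 2 / n := by field_simp
      _ ≤ 1 / 50 := by
        rw [div_le_div_iff₀ hn0 (by norm_num)]
        have : (100 : ℝ) ≤ n := by exact_mod_cast hn
        linarith

/-- The lower bound on `ε` serves here: `ε⁴ ≥ n^(-1/3)` and `ε² m₂ ≥ 4√n` give `ε⁶ m₂ ≥ 4 n^(1/6)`.
The number 1638400 is `64 · 256 · 100`. -/
lemma medium_bounds {n : ℕ} {ε m₂ : ℝ} (hεn : (n : ℝ) ^ (-(1 / 12) : ℝ) < ε) (hε2 : ε ≤ 2)
    (hn : 0 < n) (hn6 : 1638400 ≤ (n : ℝ) ^ (1 / 6 : ℝ)) (hlog : 1 ≤ Real.log n)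
    (hm : 4 * √n / ε ^ 2 ≤ m₂) :
    64 * 256 / (ε ^ 6 * m₂ * Real.log n) ≤ 1 / 100 ∧ 64 * 256 / (ε ^ 4 * m₂) ≤ 1 / 100 := by
  have hn0 : (0 : ℝ) < n := by exact_mod_cast hn
  have hε : 0 < ε := lt_of_le_of_lt (by positivity) hεn
  have h₂ : 0 < m₂ := lt_of_lt_of_le (by positivity) hm
  have hm' : 4 * √n ≤ ε ^ 2 * m₂ := by
    rw [div_le_iff₀ (by positivity)] at hm; linarith
  have e4 : (n : ℝ) ^ (-(1 / 3) : ℝ) ≤ ε ^ 4 := by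
    have : ((n : ℝ) ^ (-(1 / 12) : ℝ)) ^ 4 = (n : ℝ) ^ (-(1 / 3) : ℝ) := by
      rw [← Real.rpow_natCast, ← Real.rpow_mul hn0.le]; norm_num
    rw [← this]; gcongr
  have e5 : (n : ℝ) ^ (1 / 6 : ℝ) = (n : ℝ) ^ (-(1 / 3) : ℝ) * √n := by
    rw [Real.sqrt_eq_rpow, ← Real.rpow_add hn0]; norm_num
  have e6 : 4 * (n : ℝ) ^ (1 / 6 : ℝ) ≤ ε ^ 6 * m₂ := by
    calc 4 * (n : ℝ) ^ (1 / 6 : ℝ) = (n : ℝ) ^ (-(1 / 3) : ℝ) * (4 * √n) := by rw [e5]; ring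
      _ ≤ ε ^ 4 * (ε ^ 2 * m₂) := by gcongr
      _ = _ := by ring
  have e7 : ε ^ 6 * m₂ ≤ 4 * (ε ^ 4 * m₂) := by
    have : ε ^ 2 ≤ 2 ^ 2 := by gcongr
    calc ε ^ 6 * m₂ = ε ^ 2 * (ε ^ 4 * m₂) := by ring
      _ ≤ 2 ^ 2 * (ε ^ 4 * m₂) := by gcongr
      _ = _ := by ring
  constructor
  · rw [div_le_div_iff₀ (by positivity) (by norm_num)]
    have : ε ^ 6 * m₂ ≤ ε ^ 6 * m₂ * Real.log n := le_mul_of_one_le_right (by positivity) hlog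
    linarith
  · rw [div_le_div_iff₀ (by positivity) (by norm_num)]
    linarith

end ClosenessTesting

/-! ### Choice of constants and conclusion. -/

set_option maxHeartbeats 1000000 in
theorem mainTheorem3 :
    ∃ C₁ : ℝ, 0 < C₁ ∧ ∀ γ : ℝ, 0 < γ → ∃ Cγ : ℝ, 0 < Cγ ∧
      ∀ c c' : ℝ, 0 < c → 0 < c' → ∃ K : ℝ, 0 < K ∧ ∀ L : ℝ, K ≤ L →
        ∃ n₀ : ℕ, ∀ n : ℕ, n₀ ≤ n → ∀ ε m₁ m₂ : ℝ,
          (n : ℝ) ^ (-(1 / 12) : ℝ) < ε → ε ≤ 2 →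
          c * ((n : ℝ) / ε ^ 2) ^ (8 / 9 + γ) ≤ m₁ → m₁ ≤ c' * n →
          K * ClosenessTesting.rateQ n ε m₁ ≤ m₂ → m₂ ≤ L * ClosenessTesting.rateQ n ε m₁ →
          ∀ p q : PMF (Fin n),
            99 / 100 ≤ ClosenessTesting.dataProb p q m₁ m₂
              {s | m₁ ≤ s.numP ∧ (s.numP : ℝ) ≤ 3 * m₁ ∧
                (s.numQ : ℝ) ≤ 3 * L * ClosenessTesting.rateQ n ε m₁} ∧
            (p = q →
              2 / 3 ≤ ClosenessTesting.dataProb p q m₁ m₂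
                {s | ClosenessTesting.extremeTest ε m₁ m₂ Cγ C₁ s =
                  ClosenessTesting.Verdict.accept}) ∧
            (ε ≤ ClosenessTesting.l1Dist p q →
              2 / 3 ≤ ClosenessTesting.dataProb p q m₁ m₂
                {s | ClosenessTesting.extremeTest ε m₁ m₂ Cγ C₁ s =
                  ClosenessTesting.Verdict.reject}) := by
  refine ⟨10, by norm_num, fun γ hγ => ⟨40, by norm_num, fun c c' hc hc' =>
    ⟨1440 * (1 + c'), by positivity, fun L hL => ?_⟩⟩⟩
  -- Since `m₂ ≤ m₁ ≤ c' n`, the light case needs `80 · 9 · (2 + 2c') = 1440 (1 + c')`. Neither 10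
  -- nor 40 depends on `γ`; only the threshold for `n` does.
  set K := 1440 * (1 + c') with hK
  have hK0 : 1440 ≤ K := by linarith
  have hL0 : 0 < L := by linarith
  have hcs : 0 < √c := Real.sqrt_pos.2 hc
  set L' := L * (1 + √c') with hL'
  have hL'0 : 0 < L' := by positivity
  have hroot : Filter.Tendsto (fun N : ℝ => N ^ (1 / 9 : ℝ)) Filter.atTop Filter.atTop :=
    tendsto_rpow_atTop (by norm_num)
  have hevN : ∀ᶠ N : ℝ in Filter.atTop, 1 ≤ N ∧
      4 * N * Real.exp (-(√c ^ 3 / (40 * L') * (N ^ (γ / 2)) ^ 3)) ≤ 1 / 100 ∧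
      1 ≤ N ^ (1 / 9 : ℝ) ∧ 40 / √c ≤ N ^ (1 / 9 : ℝ) ∧ L' / √c ^ 3 ≤ N ^ (1 / 9 : ℝ) ∧
      4 * L' / √c ≤ N ^ (1 / 9 : ℝ) := by
    filter_upwards [Filter.eventually_ge_atTop 1,
      ClosenessTesting.eventually_mul_exp_neg_rpow_le (κ := √c ^ 3 / (40 * L')) (by positivity) hγ,
      hroot.eventually_ge_atTop 1, hroot.eventually_ge_atTop (40 / √c),
      hroot.eventually_ge_atTop (L' / √c ^ 3), hroot.eventually_ge_atTop (4 * L' / √c)]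
      with N h1 h2 h3 h4 h5 h6 using ⟨h1, h2, h3, h4, h5, h6⟩
  obtain ⟨N₀, hN₀⟩ := Filter.eventually_atTop.1 hevN
  have hevn : ∀ᶠ n : ℕ in Filter.atTop, 100 ≤ n ∧ 4 * N₀ ≤ (n : ℝ) ∧ 5625 ≤ Real.log n ∧
      1638400 ≤ (n : ℝ) ^ (1 / 6 : ℝ) := by
    have t := tendsto_natCast_atTop_atTop (R := ℝ)
    filter_upwards [Filter.eventually_ge_atTop 100, t.eventually_ge_atTop (4 * N₀),
      (Real.tendsto_log_atTop.comp t).eventually_ge_atTop 5625,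
      ((tendsto_rpow_atTop (y := (1 / 6 : ℝ)) (by norm_num)).comp t).eventually_ge_atTop 1638400]
      with n h1 h2 h3 h4 using ⟨h1, h2, h3, h4⟩
  obtain ⟨n₀, hn₀⟩ := Filter.eventually_atTop.1 hevn
  refine ⟨n₀, fun n hn ε m₁ m₂ hεn hε2 hm₁ hm₁' hm₂ hm₂' p q => ?_⟩
  obtain ⟨hn100, hnN, hlog, hn6⟩ := hn₀ n hn
  have hnpos : 0 < n := by omega
  have hn0 : (0 : ℝ) < n := by exact_mod_cast hnpos
  have hn100' : (100 : ℝ) ≤ n := by exact_mod_cast hn100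
  have hε : 0 < ε := lt_of_le_of_lt (by positivity) hεn
  have hε4 : ε ^ 2 ≤ 4 := (pow_le_pow_left₀ hε.le hε2 2).trans_eq (by norm_num)
  set N := (n : ℝ) / ε ^ 2 with hN
  have hNn : n = N * ε ^ 2 := by rw [hN]; field_simp
  -- Because `ε ≤ 2`, one has `N = n/ε² ≥ n/4`, so thresholds in `N` become thresholds in `n`
  -- uniformly in `ε`.
  have hNN : N₀ ≤ N := by
    rw [hN, le_div_iff₀ (by positivity)]
    rcases le_total 0 N₀ with h | h
    · nlinarith
    · nlinarith [sq_nonneg ε]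
  obtain ⟨hN1, hexp, hu1, hu2, hu3, hu4⟩ := hN₀ N hNN
  have hNpos : 0 < N := by linarith
  set u := N ^ (1 / 9 : ℝ) with hu
  have hu0 : 0 < u := by positivity
  have hpow : ∀ k : ℕ, u ^ k = N ^ ((k : ℝ) / 9) := fun k => by
    rw [hu, ← Real.rpow_natCast, ← Real.rpow_mul hNpos.le]; congr 1; ring
  set g := N ^ (γ / 2) with hg
  have hg1 : 1 ≤ g := Real.one_le_rpow hN1 (by positivity)
  have hNa : N ^ (8 / 9 + γ) = (u ^ 4 * g) ^ 2 := by
    rw [hpow, hg, ← Real.rpow_add hNpos, ← Real.rpow_natCast, ← Real.rpow_mul hNpos.le]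
    congr 1; push_cast; ring
  have h₁ : 0 < m₁ := lt_of_lt_of_le (by positivity) hm₁
  set s := √m₁ with hs
  have hs0 : 0 < s := Real.sqrt_pos.2 h₁
  have hs2 : s ^ 2 = m₁ := Real.sq_sqrt h₁.le
  have hsu : √c * u ^ 4 * g ≤ s := by
    apply Real.le_sqrt_of_sq_le
    calc (√c * u ^ 4 * g) ^ 2 = √c ^ 2 * (u ^ 4 * g) ^ 2 := by ring
      _ = c * (u ^ 4 * g) ^ 2 := by rw [Real.sq_sqrt hc.le]
      _ ≤ m₁ := by rw [← hNa]; exact hm₁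
  set r := ClosenessTesting.rateQ n ε m₁ with hr
  have hr1 : N / s ≤ r := by
    rw [hr, ClosenessTesting.rateQ, hN, div_div, mul_comm (ε ^ 2)]; exact le_max_left _ _
  have hr2 : √n / ε ^ 2 ≤ r := le_max_right _ _
  have hsc : s ≤ √c' * √n := by
    rw [hs, ← Real.sqrt_mul hc'.le]; exact Real.sqrt_le_sqrt hm₁'
  have hsn : √n * √n = n := Real.mul_self_sqrt hn0.le
  have hsn0 : 0 < √(n : ℝ) := Real.sqrt_pos.2 hn0
  have hr3 : r * s ≤ (1 + √c') * N := by
    have a1 : (n : ℝ) / (s * ε ^ 2) * s = N := by rw [hN]; field_simp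
    have a2 : √n / ε ^ 2 * s ≤ √c' * N := by
      calc √n / ε ^ 2 * s ≤ √n / ε ^ 2 * (√c' * √n) := by gcongr
        _ = √c' * (√n * √n) / ε ^ 2 := by ring
        _ = _ := by rw [hsn, hN]; ring
    rw [hr, ClosenessTesting.rateQ, ← hs, max_mul_of_nonneg _ _ hs0.le, a1]
    have : 0 ≤ √c' * N := by positivity
    refine max_le ?_ ?_ <;> linarith
  have hr0 : 0 < r := lt_of_lt_of_le (by positivity) hr1
  have h₂ : 0 < m₂ := lt_of_lt_of_le (by positivity) hm₂
  have hms : m₂ * s ≤ L' * u ^ 9 := by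
    have : u ^ 9 = N := by rw [hpow]; norm_num
    rw [this]
    calc m₂ * s ≤ L * r * s := by gcongr
      _ = L * (r * s) := by ring
      _ ≤ L * ((1 + √c') * N) := by gcongr
      _ = _ := by rw [hL']; ring
  have hu3' : L' ≤ √c ^ 3 * u ^ 3 := by
    rw [div_le_iff₀ (by positivity)] at hu3
    have : u ≤ u ^ 3 := le_self_pow₀ hu1 (by norm_num)
    calc L' ≤ u * √c ^ 3 := hu3
      _ ≤ u ^ 3 * √c ^ 3 := by gcongr
      _ = _ := by ring
  have hu4' : 4 * L' ≤ √c * u := by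
    rw [div_le_iff₀ hcs] at hu4; linarith
  obtain ⟨hmm, hm6, hτ⟩ := ClosenessTesting.sample_ratio_bounds hu0 hg1 hs0 hL'0 hc h₂ hsu hms
    hu3' hu4'
  rw [hs2] at hmm hτ
  obtain ⟨hV, hG⟩ := ClosenessTesting.heavy_and_large_bounds hε hε2 h₂ hn100 hlog
  have hm₂n : K * (√n / ε ^ 2) ≤ m₂ := le_trans (by gcongr) hm₂
  obtain ⟨hW, hW'⟩ := ClosenessTesting.medium_bounds (m₂ := m₂) hεn hε2 hnpos hn6 (by linarith)
    (by
      refine le_trans ?_ hm₂n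
      rw [mul_div_assoc]
      gcongr; linarith)
  have hτeq : m₁ * ε ^ (2 / 3 : ℝ) / (10 * m₂ * (n : ℝ) ^ (1 / 3 : ℝ)) =
      m₁ / (10 * m₂ * u ^ 3) := by
    have : u ^ 3 = (n : ℝ) ^ (1 / 3 : ℝ) / ε ^ (2 / 3 : ℝ) := by
      rw [← ClosenessTesting.div_sq_rpow_third hn0.le hε, ← hN, hpow]; norm_num
    have e0 : 0 < ε ^ (2 / 3 : ℝ) := by positivity
    rw [this]; field_simp
  refine ⟨?_, ?_, ?_⟩
  · have hm1600 : 1600 ≤ m₁ := by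
      rw [div_le_iff₀ hcs] at hu2
      have : u ≤ u ^ 4 := le_self_pow₀ hu1 (by norm_num)
      have : 40 ≤ s := by
        calc 40 ≤ u * √c := hu2
          _ ≤ u ^ 4 * √c * 1 := by rw [mul_one]; gcongr
          _ ≤ u ^ 4 * √c * g := by gcongr
          _ ≤ s := by linarith
      nlinarith
    have hr1600 : 1600 ≤ L * r := by
      have h10 : 10 ≤ √(n : ℝ) := Real.le_sqrt_of_sq_le (by linarith)
      have : 10 / 4 ≤ r := le_trans (by gcongr) hr2
      nlinarith
    have := ClosenessTesting.sample_sizes p q h₁ h₂ hm₂' hm1600 hr1600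
    simpa only [mul_assoc] using this
  · rintro rfl
    refine ClosenessTesting.accept_of_eq p hε (by linarith) h₂ hmm ?_ hV hG hW
    rw [hτeq]
    -- The sample sizes cancel up to `m₂ / (25 u⁶)`, so `m₂ ≤ u⁶/4` is exactly what is needed.
    have x1 : m₂ * (2 * m₂ * (m₁ / (10 * m₂ * u ^ 3)) / m₁) ^ 2 ≤ 1 / 100 := by
      have : m₂ * (2 * m₂ * (m₁ / (10 * m₂ * u ^ 3)) / m₁) ^ 2 = m₂ / (25 * u ^ 6) := by
        field_simp; norm_num
      rw [this, div_le_iff₀ (by positivity)]; linarith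
    have x2 : n * Real.exp (-(m₁ / (10 * m₂ * u ^ 3)) / 4) ≤ 1 / 100 := by
      refine le_trans ?_ hexp
      have : (n : ℝ) ≤ 4 * N := by
        rw [mul_comm]
        exact hNn.le.trans (mul_le_mul_of_nonneg_left hε4 hNpos.le)
      gcongr
      linarith
    linarith
  · intro hpq
    refine ClosenessTesting.reject_of_far p q hε (by linarith) h₂ hmm hV hG hW hW' ?_ ?_ hpq
    · have e1 : m₁ ^ (3 / 2 : ℝ) = s ^ 3 := by
        rw [hs, Real.sqrt_eq_rpow, ← Real.rpow_natCast, ← Real.rpow_mul h₁.le]; norm_num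
      have k1 : K * n ≤ m₂ * ε ^ 2 * s := by
        have : K * (N / s) ≤ m₂ := le_trans (by gcongr) hm₂
        calc K * n = K * (N / s) * ε ^ 2 * s := by rw [hNn]; field_simp
          _ ≤ m₂ * ε ^ 2 * s := by gcongr
      rw [e1, ← hs2]
      calc 80 * (s ^ 3 * m₂) * (2 * n + s ^ 2 + m₂)
          ≤ 80 * (s ^ 3 * m₂) * (2 * n + c' * n + c' * n) := by
            rw [hs2]; gcongr; linarith
        _ = s ^ 3 * m₂ / 9 * (K * n) := by rw [hK]; ring
        _ ≤ s ^ 3 * m₂ / 9 * (m₂ * ε ^ 2 * s) := by gcongr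
        _ = _ := by ring
    · have k2 : K / 4 * √n ≤ m₂ := by
        refine le_trans ?_ hm₂n
        rw [div_mul_eq_mul_div, mul_div_assoc]
        gcongr
      have k3 : √c' ≤ 1 + c' := ClosenessTesting.sqrt_le_one_add hc'.le
      calc 200 * s ≤ 200 * (√c' * √n) := by gcongr
        _ ≤ 200 * ((1 + c') * √n) := by gcongr
        _ ≤ K / 4 * √n := by
          rw [hK]
          have : 0 ≤ (1 + c') * √(n : ℝ) := by positivity
          linarith
        _ ≤ m₂ := k2
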